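/- Let $k\ge 1$, let $\lambda=(\lambda_1\ge\dots\ge\lambda_k\ge 0)$ be a partition with at most $k$ parts, and put $n=k+\lambda_1$ and $I(\lambda)=\{\lambda_k+1,\lambda_{k-1}+2,\dots,\lambda_1+k\}\subset\{1,\dots,n\}$. The double Schur polynomial is the flag minor $$s_\lambda(x_1,\dots,x_k\,|\,y)=\det\bigl(Z_{ij}\bigr)_{i\in I(\lambda),\,1\le j\le k},\qquad Z_{ij}=\frac{\prod_{1\le b<i}(x_j+y_b)}{\prod_{1\le a<j}(x_j-x_a)},$$ in the variables $x_1,\dots,x_k,y_1,\dots,y_{n-1}$. A subtraction-free arithmetic circuit is a finite sequence of nodes, each of which is an input variable, a positive integer scalar, or the sum, product or quotient of two earlier nodes; it computes the rational function at its last node, and its size is the number of its nodes. Bit complexity is measured on a random access machine which handles nonnegative integers (indices and addresses), charges every integer operation and memory access by the bit lengths of all numbers taking part (a multiplication by the product of the bit lengths), and carries out the nodes of a circuit one after another; the values at the nodes cannot influence the control, and every node is charged $w^2$ bit operations, where $w$ is the bit length of the numbers on which the arithmetic of the circuit is performed. These numbers are taken to be of size $w=O(\log n)$. Theorem. The polynomial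 $s_\lambda(x_1,\dots,x_k\,|\,y)$ can be computed by a subtraction-free arithmetic circuit of size $O(n^3)$, and the bit complexity of the corresponding algorithm is $O(n^3\log^2 n)$. More precisely, there is a single program that, for all $k$ and $\lambda$, given $k$ and $\lambda_1,\dots,\lambda_k$, halts after executing a subtraction-free circuit that has inputs among $x_1,\dots,x_k,y_1,\dots,y_{n-1}$ and positive integers and computes $s_\lambda(x_1,\dots,x_k\,|\,y)$; and for every constant $A$ there is a constant $C$, independent of $k$ and $\lambda$, such that the size of this circuit is at most $Cn^3$ and, with $w=A\,\ell(n)$, the total cost of the run is at most $C\,n^3\,\ell(n)^2$ bit operations, where $\ell(n)=\lfloor\log_2 n\rfloor+1$ is the bit length of $n$. -/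

import Mathlib

namespace DoubleSchur

/-! ## Double Schur polynomials -/

/-- The field `ℚ(x_1, …, x_k, y_1, …, y_m)` of rational functions. -/
abbrev RatFun (k m : ℕ) : Type := FractionRing (MvPolynomial (Fin k ⊕ Fin m) ℚ)

/-- The variable `x_{j+1}` (indices in the code start at `0`). -/
noncomputable def xVar {k m : ℕ} (j : Fin k) : RatFun k m :=
  algebraMap (MvPolynomial (Fin k ⊕ Fin m) ℚ) (RatFun k m) (MvPolynomial.X (Sum.inl j))

/-- The variable `y_{b+1}`. -/
noncomputable def yVar {k m : ℕ} (b : Fin m) : RatFun k m :=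
  algebraMap (MvPolynomial (Fin k ⊕ Fin m) ℚ) (RatFun k m) (MvPolynomial.X (Sum.inr b))

/-- The first `k` columns of the matrix `Z`: the entry in row `i + 1` and column `j + 1` is
`∏_{1 ≤ b < i+1} (x_{j+1} + y_b) / ∏_{1 ≤ a < j+1} (x_{j+1} - x_a)`. Only rows up to `m + 1` are
meaningful, and only those are used. -/
noncomputable def zEntry {k m : ℕ} (i : ℕ) (j : Fin k) : RatFun k m :=
  (∏ b : Fin m with b.val < i, (xVar j + yVar b)) / ∏ a : Fin k with a < j, (xVar j - xVar a)

/-- The elements of `I(λ) = {λ_k + 1, λ_{k-1} + 2, …, λ_1 + k}` in increasing order, shifted by `1`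
because rows are numbered from `0` in the code. -/
def schurRow {k : ℕ} (lam : Fin k → ℕ) (r : Fin k) : ℕ := lam r.rev + r.val

theorem schurRow_strictMono {k : ℕ} {lam : Fin k → ℕ} (h : Antitone lam) :
    StrictMono (schurRow lam) := by
  intro a b hab
  have h1 : lam a.rev ≤ lam b.rev := h (Fin.rev_le_rev.mpr hab.le)
  have h2 : a.val < b.val := hab
  unfold schurRow
  omega

/-- The double Schur polynomial `s_λ(x_1, …, x_k | y)`: the flag minor of `Z` in the rows `I(λ)` and
the columns `1, …, k`. (Take `m = k + λ_1 - 1`, the number of the `y` variables that occur.) -/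
noncomputable def doubleSchur {k : ℕ} (m : ℕ) (lam : Fin k → ℕ) : RatFun k m :=
  Matrix.det (Matrix.of fun r j : Fin k => zEntry (schurRow lam r) j)

/-! ## Subtraction-free arithmetic circuits -/

/-- A node of a subtraction-free circuit: an input variable `x` or `y`, a scalar input, or an
addition, multiplication or division. In a circuit `α = ℕ`, and the operands of an arithmetic gate
are positions of nodes. (With expressions for `α` this is the template of a node in a program.) -/
inductive Gate (α : Type) : Type
  | x (i : α)
  | y (i : α)
  | scalar (c : α)
  | add (a b : α)
  | mul (a b : α)
  | div (a b : α)

namespace Gate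

/-- The data carried by a node. -/
def operands {α : Type} : Gate α → List α
  | x i => [i]
  | y i => [i]
  | scalar c => [c]
  | add a b => [a, b]
  | mul a b => [a, b]
  | div a b => [a, b]

def map {α β : Type} (f : α → β) : Gate α → Gate β
  | x i => x (f i)
  | y i => y (f i)
  | scalar c => scalar (f c)
  | add a b => add (f a) (f b)
  | mul a b => mul (f a) (f b)
  | div a b => div (f a) (f b)

/-- The node at position `t` of a circuit is legitimate and is correctly evaluated by `v`, where
`v s` is the value at position `s`. Variables are taken from `x_1, …, x_k, y_1, …, y_m`, scalars are
positive integers, operands are earlier nodes, and one never divides by the zero function. -/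
def Holds {k m : ℕ} (v : ℕ → RatFun k m) (t : ℕ) : Gate ℕ → Prop
  | x i => ∃ h : i < k, v t = xVar ⟨i, h⟩
  | y i => ∃ h : i < m, v t = yVar ⟨i, h⟩
  | scalar c => 0 < c ∧ v t = (c : RatFun k m)
  | add a b => a < t ∧ b < t ∧ v t = v a + v b
  | mul a b => a < t ∧ b < t ∧ v t = v a * v b
  | div a b => a < t ∧ b < t ∧ v b ≠ 0 ∧ v t = v a / v b

end Gate

/-- A subtraction-free circuit as the list of its nodes, the last one being the output. Its length,
which counts the inputs as well as the arithmetic gates, is its size. -/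
abbrev Circuit : Type := List (Gate ℕ)

/-- The circuit `c` is well formed, has inputs among `x_1, …, x_k, y_1, …, y_m` and positive
integers, and computes the rational function `f`. -/
def Circuit.Computes {k m : ℕ} (c : Circuit) (f : RatFun k m) : Prop :=
  ∃ v : ℕ → RatFun k m,
    (∀ (t : ℕ) (ht : t < c.length), (c.get ⟨t, ht⟩).Holds v t) ∧ c ≠ [] ∧ v (c.length - 1) = f

/-! ## A random access machine with bit costs

The machine has registers and an indirectly addressed memory, both holding natural numbers. It
controls an arithmetic unit: the command `emit` loads an input or performs one operation `+`, `*`,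
`/` on numbers produced earlier (referred to by their serial numbers). The control cannot inspect
those numbers, so a run of the machine is an execution of a circuit, namely of the list of emitted
nodes. Integer operations of the control are charged by the bit lengths of all numbers that take
part in them (multiplication by the product of the bit lengths); an operation of the arithmetic unit
is charged `w ^ 2`, where `w` is the bit length of the numbers it works with. -/

/-- Integer expressions of the control; `sub` is truncated at `0`. -/
inductive Expr : Type
  | lit (c : ℕ)
  | reg (r : ℕ)
  | mem (e : Expr)
  | add (e f : Expr)
  | sub (e f : Expr)
  | mul (e f : Expr)

/-- Programs. Tests succeed on nonzero values. -/
inductive Program : Type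
  | skip
  | set (r : ℕ) (e : Expr)
  | store (addr e : Expr)
  | emit (g : Gate Expr)
  | seq (p q : Program)
  | ite (e : Expr) (p q : Program)
  | loop (e : Expr) (p : Program)

structure State : Type where
  reg : ℕ → ℕ
  mem : ℕ → ℕ
  out : Circuit

namespace Expr

def eval (s : State) : Expr → ℕ
  | lit c => c
  | reg r => s.reg r
  | mem e => s.mem (eval s e)
  | add e f => eval s e + eval s f
  | sub e f => eval s e - eval s f
  | mul e f => eval s e * eval s f

/-- The number of bit operations charged for the evaluation (`Nat.size` is the bit length). -/
def cost (s : State) : Expr → ℕ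
  | lit c => c.size + 1
  | reg r => (s.reg r).size + 1
  | mem e => cost s e + (eval s e).size + (s.mem (eval s e)).size + 1
  | add e f => cost s e + cost s f + (eval s e).size + (eval s f).size + 1
  | sub e f => cost s e + cost s f + (eval s e).size + (eval s f).size + 1
  | mul e f => cost s e + cost s f + ((eval s e).size + 1) * ((eval s f).size + 1)

end Expr

/-- `Exec w p s s' t`: with an arithmetic unit working on `w`-bit numbers, the program `p` started
in the state `s` halts in the state `s'`, and the total cost of the run is `t` bit operations. -/
inductive Exec (w : ℕ) : Program → State → State → ℕ → Prop
  | skip (s : State) : Exec w .skip s s 1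
  | set (s : State) (r : ℕ) (e : Expr) :
      Exec w (.set r e) s { s with reg := Function.update s.reg r (e.eval s) }
        (e.cost s + (e.eval s).size + 1)
  | store (s : State) (addr e : Expr) :
      Exec w (.store addr e) s { s with mem := Function.update s.mem (addr.eval s) (e.eval s) }
        (addr.cost s + e.cost s + (addr.eval s).size + (e.eval s).size + 1)
  | emit (s : State) (g : Gate Expr) :
      Exec w (.emit g) s { s with out := s.out ++ [g.map (Expr.eval s)] }
        ((g.operands.map (Expr.cost s)).sum + s.out.length.size + w ^ 2 + 1)
  | seq {p q : Program} {s₁ s₂ s₃ : State} {t₁ t₂ : ℕ} :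
      Exec w p s₁ s₂ t₁ → Exec w q s₂ s₃ t₂ → Exec w (.seq p q) s₁ s₃ (t₁ + t₂)
  | ite_true {e : Expr} {p q : Program} {s s' : State} {t : ℕ} :
      e.eval s ≠ 0 → Exec w p s s' t → Exec w (.ite e p q) s s' (e.cost s + t + 1)
  | ite_false {e : Expr} {p q : Program} {s s' : State} {t : ℕ} :
      e.eval s = 0 → Exec w q s s' t → Exec w (.ite e p q) s s' (e.cost s + t + 1)
  | loop_true {e : Expr} {p : Program} {s₁ s₂ s₃ : State} {t₁ t₂ : ℕ} :
      e.eval s₁ ≠ 0 → Exec w p s₁ s₂ t₁ → Exec w (.loop e p) s₂ s₃ t₂ →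
        Exec w (.loop e p) s₁ s₃ (e.cost s₁ + t₁ + t₂ + 1)
  | loop_false {e : Expr} {p : Program} {s : State} :
      e.eval s = 0 → Exec w (.loop e p) s s (e.cost s + 1)

/-- The start on the input `λ = (λ_1, …, λ_k)`: register `0` holds `k`, memory cells `0, …, k - 1`
hold `λ_1, …, λ_k`, everything else is zero, and no arithmetic has been performed. -/
def initState {k : ℕ} (lam : Fin k → ℕ) : State where
  reg := fun r => if r = 0 then k else 0
  mem := fun a => if h : a < k then lam ⟨a, h⟩ else 0
  out := []

end DoubleSchur

/-! Let `μ` list the parts of `λ` in increasing order. The rows `i + min s (μ i)` form an interval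
at `s = 0` and, for `i < k`, the set `I(λ)` at `s = λ_1`. The circuit computes, for every `s`, the
minors of `Z` in the windows of `l` consecutive members of this sequence and the first `l` columns
(`windowMinor`). At `s = 0` such a minor is a Vandermonde determinant divided by the denominators of
`Z`, so it equals the product of the `x j + y b` over `j < l`, `b < a` (`leadingMinor_zMatrix`).
From `s` to `s + 1` exactly the rows with `μ > s` move up by one, and these are the last ones of the
window. If all or none of them move, the new minor is an old one. Otherwise the new row set is the
old window, lengthened by one row, with one inner row omitted. A three-term relation with plus signs
only (`leadingMinor_exchange`) then gives the new minor from old ones and shorter new ones by one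
addition and one division (`windowMinor_exchange`). The divisor is nonzero because all these minors
are quotients of polynomials positive at `(1, …, 1)` (`isPositive_windowMinor`). There are `O(n ^
3)` triples `(s, l, a)`. Each is given exactly five nodes, so node positions are arithmetic
expressions in the loop counters and no address table is needed. All control numbers are at most `20
* n ^ 3`, hence have `O(log n)` bits. Each of the `O(n ^ 3)` rounds of the three nested loops
therefore costs `O(log ^ 2 n)`. -/

namespace DoubleSchur

open Finset Matrix

/-! ## Determinantal identities -/

section Determinants

variable {R : Type*} [CommRing R]

/-- The identity matrix with its first and last columns replaced by those of the adjugate. -/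
def adjugateFrame {m : ℕ} (M : Matrix (Fin (m + 2)) (Fin (m + 2)) R) :
    Matrix (Fin (m + 2)) (Fin (m + 2)) R :=
  of fun i j => if j = 0 ∨ j = Fin.last _ then M.adjugate i j else (1 : Matrix _ _ R) i j

theorem det_adjugateFrame {m : ℕ} (M : Matrix (Fin (m + 2)) (Fin (m + 2)) R) :
    (adjugateFrame M).det =
      (M.submatrix Fin.succ Fin.succ).det * (M.submatrix Fin.castSucc Fin.castSucc).det -
      (M.submatrix Fin.succ Fin.castSucc).det * (M.submatrix Fin.castSucc Fin.succ).det := by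
  -- The central block is the identity, and by `hz` the middle columns vanish in the first and last
  -- rows. Hence the determinant is the 2 × 2 determinant of the four corners, which are adjugate
  -- entries.
  have hid : ∀ f g : Fin m → Fin (m + 2), (∀ i, f i = i.succ.castSucc) →
      (∀ i, g i = i.succ.castSucc) → ((adjugateFrame M).submatrix f g).det = 1 := by
    intro f g hf hg
    rw [← det_one (n := Fin m)]
    congr 1
    ext i j
    have h1 : ¬ (j.succ.castSucc = (0 : Fin (m + 2)) ∨ j.succ.castSucc = Fin.last (m + 1)) := by
      rw [Fin.ext_iff, Fin.ext_iff]
      have := j.isLt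
      simp
      omega
    simp only [adjugateFrame, submatrix_apply, of_apply, hf, hg, if_neg h1, one_apply]
    simp [Fin.ext_iff]
  have hz : ∀ i j : Fin (m + 2), ¬ (j = 0 ∨ j = Fin.last _) → (i = 0 ∨ i = Fin.last _) →
      adjugateFrame M i j = 0 := by
    intro i j hj hi
    simp only [adjugateFrame, of_apply, if_neg hj]
    rw [one_apply_ne]
    rintro rfl
    exact hj hi
  have e0 : ((adjugateFrame M).submatrix Fin.succ Fin.succ).det =
      M.adjugate (Fin.last _) (Fin.last _) := by
    rw [det_succ_row _ (Fin.last m), sum_eq_single (Fin.last m)]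
    · rw [submatrix_submatrix, hid _ _ (fun i => by simp)
        (fun i => by simp), ← two_mul]
      simp [adjugateFrame]
    · intro j _ hj
      rw [submatrix_apply, hz _ _ _ (Or.inr (by simp))]
      · simp
      · have := Fin.val_lt_last hj
        simp only [Fin.ext_iff, Fin.val_succ, Fin.val_zero, Fin.val_last]
        omega
    · simp
  have e1 : ((adjugateFrame M).submatrix Fin.succ Fin.castSucc).det =
      (-1) ^ m * M.adjugate (Fin.last _) 0 := by
    rw [det_succ_row _ (Fin.last m), sum_eq_single 0]
    · rw [submatrix_submatrix, hid _ _ (fun i => by simp)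
        (fun i => by simp)]
      simp [adjugateFrame]
    · intro j _ hj
      rw [submatrix_apply, hz _ _ _ (Or.inr (by simp))]
      · simp
      · have := j.isLt
        have := Fin.pos_of_ne_zero hj
        simp only [Fin.lt_def, Fin.ext_iff, Fin.val_castSucc, Fin.val_zero, Fin.val_last] at this ⊢
        omega
    · simp
  have h0 : ∀ i : Fin m, adjugateFrame M 0 i.castSucc.succ = 0 := fun i => by
    refine hz _ _ ?_ (Or.inl rfl)
    have := i.isLt
    simp only [Fin.ext_iff, Fin.val_succ, Fin.val_castSucc, Fin.val_zero, Fin.val_last]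
    omega
  rw [det_succ_row_zero, Fin.sum_univ_succ, Fin.sum_univ_castSucc]
  simp only [h0, Fin.succ_last, mul_zero, zero_mul, sum_const_zero, Fin.succAbove_zero,
    Fin.succAbove_last, e0, e1]
  simp only [adjugateFrame, of_apply, adjugate_fin_succ_eq_det_submatrix, Fin.succAbove_zero,
    Fin.succAbove_last]
  simp only [Fin.val_zero, Fin.val_last]
  have hs : ((-1 : R) ^ m) * (-1) ^ m = 1 := by rw [← pow_add, ← two_mul]; simp
  simp [pow_succ, pow_add]
  linear_combination ((M.submatrix Fin.succ Fin.succ).det *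
    (M.submatrix Fin.castSucc Fin.castSucc).det - (1 + (-1) ^ m * (-1) ^ m) *
    (M.submatrix Fin.succ Fin.castSucc).det * (M.submatrix Fin.castSucc Fin.succ).det) * hs

/-- Since `M * M.adjugate = M.det • 1`, the outer columns of the product are `M.det` times unit
vectors, while the middle columns are those of `M`. -/
theorem det_mul_adjugateFrame {m : ℕ} (M : Matrix (Fin (m + 2)) (Fin (m + 2)) R) :
    (M * adjugateFrame M).det =
      M.det * (M.det * (M.submatrix (fun i : Fin m => i.succ.castSucc)
        (fun i : Fin m => i.succ.castSucc)).det) := by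
  have hb : ∀ i j : Fin (m + 2), (j = 0 ∨ j = Fin.last _) →
      (M * adjugateFrame M) i j = M.det * (1 : Matrix _ _ R) i j := by
    intro i j hj
    have := congrFun (congrFun (mul_adjugate M) i) j
    rw [Matrix.smul_apply, smul_eq_mul] at this
    rw [← this]
    simp [mul_apply, adjugateFrame, hj]
  have hm : ∀ i j : Fin (m + 2), ¬ (j = 0 ∨ j = Fin.last _) →
      (M * adjugateFrame M) i j = M i j := by
    intro i j hj
    simp [mul_apply, adjugateFrame, hj, one_apply]
  rw [det_succ_column_zero, sum_eq_single 0]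
  · rw [det_succ_column _ (Fin.last m), sum_eq_single (Fin.last m)]
    · rw [submatrix_submatrix, submatrix_apply, hb _ _ (Or.inl rfl), hb _ _ (Or.inr (by simp)),
        ← two_mul]
      have : (M * adjugateFrame M).submatrix ((Fin.succAbove 0) ∘ (Fin.last m).succAbove)
          (Fin.succ ∘ (Fin.last m).succAbove) = M.submatrix (fun i : Fin m => i.succ.castSucc)
          (fun i : Fin m => i.succ.castSucc) := by
        ext i j
        have := j.isLt
        rw [submatrix_apply, submatrix_apply, hm]
        · congr 1 <;> simp
        · simp [Fin.ext_iff]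
          omega
      rw [this, Fin.succAbove_zero, Fin.succ_last, one_apply_eq, one_apply_eq]
      simp
    · intro i _ hi
      rw [submatrix_apply, hb _ _ (Or.inr (by simp)), one_apply_ne]
      · simp
      · simp only [Fin.succAbove_zero, ne_eq, Fin.ext_iff, Fin.val_succ, Fin.val_last] at hi ⊢
        omega
    · simp
  · intro i _ hi
    rw [hb _ _ (Or.inl rfl), one_apply_ne hi]
    simp
  · simp

theorem dodgson_of_isDomain {m : ℕ} [IsDomain R] (M : Matrix (Fin (m + 2)) (Fin (m + 2)) R)
    (hM : M.det ≠ 0) :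
    M.det * (M.submatrix (fun i : Fin m => i.succ.castSucc)
        (fun i : Fin m => i.succ.castSucc)).det =
      (M.submatrix Fin.succ Fin.succ).det * (M.submatrix Fin.castSucc Fin.castSucc).det -
      (M.submatrix Fin.succ Fin.castSucc).det * (M.submatrix Fin.castSucc Fin.succ).det := by
  apply mul_left_cancel₀ hM
  rw [← det_mul_adjugateFrame, det_mul, det_adjugateFrame]

/-- The Desnanot–Jacobi identity. -/
theorem dodgson_condensation {m : ℕ} (M : Matrix (Fin (m + 2)) (Fin (m + 2)) R) :
    M.det * (M.submatrix (fun i : Fin m => i.succ.castSucc)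
        (fun i : Fin m => i.succ.castSucc)).det =
      (M.submatrix Fin.succ Fin.succ).det * (M.submatrix Fin.castSucc Fin.castSucc).det -
      (M.submatrix Fin.succ Fin.castSucc).det * (M.submatrix Fin.castSucc Fin.succ).det := by
  -- The identity is polynomial in the entries: it holds for the generic integer matrix, whose
  -- determinant can be cancelled, and `φ` specialises it to `M`.
  have h := dodgson_of_isDomain _ (det_mvPolynomialX_ne_zero (Fin (m + 2)) ℤ)
  let φ : MvPolynomial (Fin (m + 2) × Fin (m + 2)) ℤ →+* R :=
    MvPolynomial.eval₂Hom (Int.castRingHom R) fun p => M p.1 p.2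
  have hφ : φ.mapMatrix (mvPolynomialX (Fin (m + 2)) (Fin (m + 2)) ℤ) = M := by
    ext i j
    simp [φ, mvPolynomialX]
  have key : ∀ {l : ℕ} (f g : Fin l → Fin (m + 2)),
      φ ((mvPolynomialX (Fin (m + 2)) (Fin (m + 2)) ℤ).submatrix f g).det =
        (M.submatrix f g).det := by
    intro l f g
    rw [RingHom.map_det]
    congr 1
    ext i j
    simp [φ, mvPolynomialX]
  have h' := congrArg φ h
  rw [map_mul, map_sub, map_mul, map_mul, RingHom.map_det, hφ] at h'
  simpa only [key] using h'

/-! ### Flag minors and their three-term relation. -/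

/-- The minor of an infinite matrix in its first `l` rows and columns. -/
def leadingMinor (F : ℕ → ℕ → R) (l : ℕ) : R := (of fun i j : Fin l => F i j).det

/-- The order embedding of `ℕ` in `ℕ` which omits `p`. -/
def skip (p i : ℕ) : ℕ := if i < p then i else i + 1

/-- `F` with a column in front that marks row `p`. -/
def markRow (F : ℕ → ℕ → R) (p i : ℕ) : ℕ → R
  | 0 => if i = p then 1 else 0
  | j + 1 => F i j

theorem leadingMinor_markRow (F : ℕ → ℕ → R) (p l : ℕ) (hp : p ≤ l) :
    leadingMinor (markRow F p) (l + 1) = (-1) ^ p * leadingMinor (fun i => F (skip p i)) l := by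
  unfold leadingMinor
  rw [det_succ_column_zero, sum_eq_single ⟨p, by omega⟩]
  · simp only [of_apply, Fin.val_zero, markRow, if_true, mul_one]
    congr 2
    ext i j
    simp only [submatrix_apply, of_apply, Fin.val_succ, Fin.succAbove, skip, Fin.lt_def,
      Fin.val_castSucc]
    split <;> simp
  · intro i _ hi
    have : (i : ℕ) ≠ p := fun h => hi (Fin.ext h)
    simp [markRow, this]
  · simp

/-- The three-term relation between flag minors: `0`, `p` and the last row are exchanged. -/
theorem leadingMinor_exchange (F : ℕ → ℕ → R) (p m : ℕ) (hp : 0 < p) (hpm : p ≤ m) :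
    leadingMinor (fun i => F (skip p i)) (m + 1) * leadingMinor (fun i => F (i + 1)) m =
      leadingMinor F (m + 1) * leadingMinor (fun i => F (skip p (i + 1))) m +
      leadingMinor (fun i => F (i + 1)) (m + 1) * leadingMinor (fun i => F (skip p i)) m := by
  obtain ⟨q, rfl⟩ : ∃ q, p = q + 1 := ⟨p - 1, by omega⟩
  obtain ⟨m', rfl⟩ : ∃ m', m = m' + 1 := ⟨m - 1, by omega⟩
  -- A minor containing the marker column reduces, up to sign, to one with row `p` omitted. Deleting
  -- the first row lowers the position of the mark by one, so one term gains an extra sign. This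
  -- turns the difference in the condensation formula into a sum.
  have hD := dodgson_condensation (of fun i j : Fin (m' + 1 + 2) => markRow F (q + 1) i j)
  have h1 := leadingMinor_markRow F (q + 1) (m' + 1 + 1) (by omega)
  have h2 := leadingMinor_markRow F (q + 1) (m' + 1) (by omega)
  have h3 := leadingMinor_markRow (fun i => F (i + 1)) q (m' + 1) (by omega)
  have e3 : (fun i => F (skip q i + 1)) = fun i => F (skip (q + 1) (i + 1)) := by
    funext i
    congr 1
    unfold skip
    split_ifs <;> omega
  rw [e3] at h3
  have e4 : (markRow (fun i => F (i + 1)) q) = fun i => markRow F (q + 1) (i + 1) := by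
    funext i j
    cases j <;> simp [markRow]
  rw [e4] at h3
  have hs : ((-1 : R) ^ q) * (-1) ^ q = 1 := by rw [← pow_add, ← two_mul]; simp
  have d0 : (of fun i j : Fin (m' + 1 + 2) => markRow F (q + 1) i j).det =
    leadingMinor (markRow F (q + 1)) (m' + 1 + 1 + 1) := rfl
  have d1 : ((of fun i j : Fin (m' + 1 + 2) => markRow F (q + 1) i j).submatrix
      (fun i : Fin (m' + 1) => i.succ.castSucc) (fun i : Fin (m' + 1) => i.succ.castSucc)).det =
    leadingMinor (fun i => F (i + 1)) (m' + 1) := rfl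
  have d2 : ((of fun i j : Fin (m' + 1 + 2) => markRow F (q + 1) i j).submatrix
      Fin.succ Fin.succ).det = leadingMinor (fun i => F (i + 1)) (m' + 1 + 1) := rfl
  have d3 : ((of fun i j : Fin (m' + 1 + 2) => markRow F (q + 1) i j).submatrix
      Fin.castSucc Fin.castSucc).det = leadingMinor (markRow F (q + 1)) (m' + 1 + 1) := rfl
  have d4 : ((of fun i j : Fin (m' + 1 + 2) => markRow F (q + 1) i j).submatrix
      Fin.succ Fin.castSucc).det =
    leadingMinor (fun i => markRow F (q + 1) (i + 1)) (m' + 1 + 1) := rfl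
  have d5 : ((of fun i j : Fin (m' + 1 + 2) => markRow F (q + 1) i j).submatrix
      Fin.castSucc Fin.succ).det = leadingMinor F (m' + 1 + 1) := rfl
  rw [d0, d1, d2, d3, d4, d5, h1, h2, h3] at hD
  simp only [pow_succ] at hD
  linear_combination (-(-1) ^ q) * hD + (leadingMinor (fun i => F (i + 1)) (m' + 1 + 1) *
    leadingMinor (fun i => F (skip (q + 1) i)) (m' + 1) + leadingMinor F (m' + 1 + 1) *
    leadingMinor (fun i => F (skip (q + 1) (i + 1))) (m' + 1) -
    leadingMinor (fun i => F (skip (q + 1) i)) (m' + 1 + 1) *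
      leadingMinor (fun i => F (i + 1)) (m' + 1)) * hs

theorem leadingMinor_congr {F G : ℕ → ℕ → R} {l : ℕ} (h : ∀ i < l, ∀ j < l, F i j = G i j) :
    leadingMinor F l = leadingMinor G l := by
  unfold leadingMinor
  congr 1
  ext i j
  exact h i i.isLt j j.isLt

end Determinants

/-! ## The matrix `Z` -/

section Factorial

variable {K : Type*} [Field K]

/-- The matrix `Z` for arbitrary sequences `x` and `y`. -/
def zMatrix (x y : ℕ → K) (i j : ℕ) : K :=
  (∏ b ∈ range i, (x j + y b)) / ∏ a ∈ range j, (x j - x a)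

theorem det_vandermonde_eq_prod_range (x : ℕ → K) (l : ℕ) :
    (vandermonde fun j : Fin l => x j).det = ∏ j : Fin l, ∏ a ∈ range j, (x j - x a) := by
  rw [det_vandermonde, prod_comm' (t' := univ) (s' := fun j => Iio j) (by simp)]
  refine prod_congr rfl fun j _ => ?_
  have : range (j : ℕ) = (Iio j).map Fin.valEmbedding := by
    rw [Fin.map_valEmbedding_Iio]
    ext
    simp
  rw [this, prod_map]
  rfl

/-- The minors of `Z` in consecutive rows. -/
theorem leadingMinor_zMatrix (x y : ℕ → K) (c l : ℕ)
    (hx : ∀ i < l, ∀ j < l, x i = x j → i = j) :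
    leadingMinor (fun i => zMatrix x y (c + i)) l =
      ∏ j ∈ range l, ∏ b ∈ range c, (x j + y b) := by
  classical
  let p : Fin l → Polynomial K := fun i =>
    ∏ b ∈ range (i : ℕ), (Polynomial.X + Polynomial.C (y (c + b)))
  have hmon : ∀ i, (p i).Monic := fun i =>
    Polynomial.monic_prod_of_monic _ _ fun b _ => Polynomial.monic_X_add_C _
  have hdeg : ∀ i, (p i).natDegree = i := fun i => by
    rw [Polynomial.natDegree_prod_of_monic _ _ fun b _ => Polynomial.monic_X_add_C _]
    simp
  have hV := det_eval_matrixOfPolynomials_eq_det_vandermonde (fun j : Fin l => x j) p hdeg hmon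
  let A : Matrix (Fin l) (Fin l) K := of fun i j => (p i).eval (x j)
  have hA : (of fun i j : Fin l => (p j).eval (x i)) = Aᵀ := rfl
  rw [hA, det_transpose, det_vandermonde_eq_prod_range] at hV
  have hne : ∀ j : Fin l, ∏ a ∈ range (j : ℕ), (x j - x a) ≠ 0 := fun j => by
    rw [prod_ne_zero_iff]
    intro a ha h
    have ha' := mem_range.mp ha
    have := hx j j.isLt a (ha'.trans j.isLt) (sub_eq_zero.mp h)
    omega
  -- In consecutive rows, column `j` is a common factor times the values at `x j` of monic
  -- polynomials of degrees `0, …, l - 1`. Their determinant is Vandermonde's and cancels the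
  -- denominators.
  have hM : (of fun i j : Fin l => zMatrix x y (c + i) j) =
      of fun i j : Fin l => ((∏ b ∈ range c, (x j + y b)) / ∏ a ∈ range (j : ℕ), (x j - x a)) *
        A i j := by
    ext i j
    simp only [of_apply, A, p, zMatrix, prod_range_add, Polynomial.eval_prod,
      Polynomial.eval_add, Polynomial.eval_X, Polynomial.eval_C]
    ring
  unfold leadingMinor
  rw [hM, det_mul_row, ← hV, ← prod_mul_distrib, ← Fin.prod_univ_eq_prod_range
    (fun j => ∏ b ∈ range c, (x j + y b))]
  exact prod_congr rfl fun j _ => div_mul_cancel₀ _ (hne j)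

end Factorial

end DoubleSchur

namespace DoubleSchur

open Finset Matrix

/-! ## Growing the rows of the minors one step at a time -/

section Rows

variable {K : Type*} [Field K]

/-- The sequence of rows `i + min s (μ i)`, which moves from the initial interval at `s = 0` towards
`i + μ i`. -/
def rowSeq (μ : ℕ → ℕ) (s i : ℕ) : ℕ := i + min s (μ i)

/-- The flag minor of `Z` in the rows `rowSeq μ s a, …, rowSeq μ s (a + l - 1)`. -/
def windowMinor (x y : ℕ → K) (μ : ℕ → ℕ) (s a l : ℕ) : K :=
  leadingMinor (fun i => zMatrix x y (rowSeq μ s (a + i))) l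

variable (x y : ℕ → K) {μ : ℕ → ℕ} {s a : ℕ}

theorem windowMinor_zero_right (μ : ℕ → ℕ) (s a : ℕ) : windowMinor x y μ s a 0 = 1 := by
  simp [windowMinor, leadingMinor]

/-- Every row of the window moves, which amounts to shifting the window by one. -/
theorem windowMinor_succ_of_lt (hμ : Monotone μ) (h : s < μ a) (l : ℕ) :
    windowMinor x y μ (s + 1) a l = windowMinor x y μ s (a + 1) l := by
  refine leadingMinor_congr fun i _ j _ => ?_
  have h1 : μ a ≤ μ (a + i) := hμ (by omega)
  have h2 : μ a ≤ μ (a + 1 + i) := hμ (by omega)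
  have : rowSeq μ (s + 1) (a + i) = rowSeq μ s (a + 1 + i) := by
    unfold rowSeq
    omega
  rw [this]

theorem windowMinor_succ_of_le (hμ : Monotone μ) {l : ℕ} (h : μ (a + l - 1) ≤ s) :
    windowMinor x y μ (s + 1) a l = windowMinor x y μ s a l := by
  refine leadingMinor_congr fun i hi j _ => ?_
  have h1 : μ (a + i) ≤ μ (a + l - 1) := hμ (by omega)
  have : rowSeq μ (s + 1) (a + i) = rowSeq μ s (a + i) := by
    unfold rowSeq
    omega
  rw [this]

theorem windowMinor_exchange (hμ : Monotone μ) {m : ℕ} (h1 : μ a ≤ s) (h2 : s < μ (a + m)) :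
    windowMinor x y μ (s + 1) a (m + 1) * windowMinor x y μ s (a + 1) m =
      windowMinor x y μ s a (m + 1) * windowMinor x y μ (s + 1) (a + 1) m +
      windowMinor x y μ s (a + 1) (m + 1) * windowMinor x y μ (s + 1) a m := by
  -- Let `p` be the first moving row. From `p` on the rows at level `s` are consecutive, so moving
  -- them up by one is the same as omitting `p` and taking one more row at the end.
  have hex : ∃ i, s < μ (a + i) := ⟨m, h2⟩
  have hp := Nat.find_spec hex
  have hmin := fun i => Nat.find_min (m := i) hex
  have hpm : Nat.find hex ≤ m := Nat.find_min' hex h2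
  generalize Nat.find hex = p at *
  have hp0 : 0 < p := by
    rcases Nat.eq_zero_or_pos p with rfl | h
    · exact absurd h1 (not_le.mpr hp)
    · exact h
  have hrow : ∀ i, rowSeq μ (s + 1) (a + i) = rowSeq μ s (a + skip p i) := by
    intro i
    unfold rowSeq skip
    split
    · have := hmin i ‹_›
      omega
    · have h3 : μ (a + p) ≤ μ (a + i) := hμ (by omega)
      have h4 : μ (a + p) ≤ μ (a + (i + 1)) := hμ (by omega)
      omega
  have := leadingMinor_exchange (fun i => zMatrix x y (rowSeq μ s (a + i))) p m hp0 hpm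
  simp only [← hrow] at this
  simpa only [windowMinor, add_assoc, add_comm 1] using this

theorem windowMinor_zero_left (l : ℕ) (hx : ∀ i < l, ∀ j < l, x i = x j → i = j) :
    windowMinor x y μ 0 a l = ∏ j ∈ range l, ∏ b ∈ range a, (x j + y b) := by
  rw [← leadingMinor_zMatrix x y a l hx]
  simp [windowMinor, rowSeq]

end Rows

/-! ## Positive rational functions -/

section Positive

variable {k m : ℕ}

/-- Quotients of polynomials that are positive at `(1, …, 1)`. -/
def IsPositive (f : RatFun k m) : Prop :=
  ∃ p q : MvPolynomial (Fin k ⊕ Fin m) ℚ, 0 < MvPolynomial.eval (fun _ => 1) p ∧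
    0 < MvPolynomial.eval (fun _ => 1) q ∧
    f = algebraMap _ (RatFun k m) p / algebraMap _ (RatFun k m) q

theorem algebraMap_ne_zero_of_eval_pos {p : MvPolynomial (Fin k ⊕ Fin m) ℚ}
    (h : 0 < MvPolynomial.eval (fun _ => 1) p) : algebraMap _ (RatFun k m) p ≠ 0 := by
  intro h0
  rw [(injective_iff_map_eq_zero' _).mp (IsFractionRing.injective _ (RatFun k m))] at h0
  simp [h0] at h

theorem IsPositive.ne_zero {f : RatFun k m} (h : IsPositive f) : f ≠ 0 := by
  obtain ⟨p, q, hp, hq, rfl⟩ := h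
  exact div_ne_zero (algebraMap_ne_zero_of_eval_pos hp) (algebraMap_ne_zero_of_eval_pos hq)

theorem isPositive_algebraMap {p : MvPolynomial (Fin k ⊕ Fin m) ℚ}
    (h : 0 < MvPolynomial.eval (fun _ => 1) p) : IsPositive (algebraMap _ (RatFun k m) p) :=
  ⟨p, 1, h, by simp, by simp⟩

theorem isPositive_one : IsPositive (1 : RatFun k m) := by
  simpa using isPositive_algebraMap (k := k) (m := m) (p := 1) (by simp)

theorem IsPositive.add {f g : RatFun k m} (hf : IsPositive f) (hg : IsPositive g) :
    IsPositive (f + g) := by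
  obtain ⟨p, q, hp, hq, rfl⟩ := hf
  obtain ⟨p', q', hp', hq', rfl⟩ := hg
  refine ⟨p * q' + q * p', q * q', ?_, ?_, ?_⟩
  · simp only [map_add, map_mul]
    positivity
  · simp only [map_mul]
    positivity
  · rw [div_add_div _ _ (algebraMap_ne_zero_of_eval_pos hq) (algebraMap_ne_zero_of_eval_pos hq')]
    simp only [map_add, map_mul]

theorem IsPositive.mul {f g : RatFun k m} (hf : IsPositive f) (hg : IsPositive g) :
    IsPositive (f * g) := by
  obtain ⟨p, q, hp, hq, rfl⟩ := hf
  obtain ⟨p', q', hp', hq', rfl⟩ := hg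
  refine ⟨p * p', q * q', ?_, ?_, ?_⟩
  · simp only [map_mul]
    positivity
  · simp only [map_mul]
    positivity
  · rw [div_mul_div_comm, map_mul, map_mul]

theorem IsPositive.div {f g : RatFun k m} (hf : IsPositive f) (hg : IsPositive g) :
    IsPositive (f / g) := by
  obtain ⟨p, q, hp, hq, rfl⟩ := hf
  obtain ⟨p', q', hp', hq', rfl⟩ := hg
  refine ⟨p * q', q * p', ?_, ?_, ?_⟩
  · simp only [map_mul]
    positivity
  · simp only [map_mul]
    positivity
  · rw [div_div_div_eq, map_mul, map_mul]

theorem IsPositive.prod {ι : Type*} (s : Finset ι) {f : ι → RatFun k m}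
    (hf : ∀ i ∈ s, IsPositive (f i)) : IsPositive (∏ i ∈ s, f i) :=
  Finset.prod_induction f IsPositive (fun _ _ => IsPositive.mul) isPositive_one hf

/-- The variables `x`, continued by `1`. -/
noncomputable def xSeq (k m : ℕ) (j : ℕ) : RatFun k m := if h : j < k then xVar ⟨j, h⟩ else 1

/-- The variables `y`, continued by `1`. -/
noncomputable def ySeq (k m : ℕ) (b : ℕ) : RatFun k m := if h : b < m then yVar ⟨b, h⟩ else 1

theorem isPositive_xSeq (j : ℕ) : IsPositive (xSeq k m j) := by
  unfold xSeq
  split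
  · exact isPositive_algebraMap (by simp)
  · exact isPositive_one

theorem isPositive_ySeq (b : ℕ) : IsPositive (ySeq k m b) := by
  unfold ySeq
  split
  · exact isPositive_algebraMap (by simp)
  · exact isPositive_one

theorem xVar_injective : Function.Injective (xVar : Fin k → RatFun k m) := fun i j h => by
  have := MvPolynomial.X_injective (IsFractionRing.injective _ (RatFun k m) h)
  simpa using this

theorem xSeq_injOn {l : ℕ} (hl : l ≤ k) :
    ∀ i < l, ∀ j < l, xSeq k m i = xSeq k m j → i = j := by
  intro i hi j hj h
  rw [xSeq, xSeq, dif_pos (by omega), dif_pos (by omega)] at h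
  simpa using xVar_injective h

/-- The recursion of the circuit itself, as an induction on `s` and then on `l`. The bound `l ≤ k`
keeps the `x` distinct, since `xSeq` is constant from `k` on. -/
theorem isPositive_windowMinor {μ : ℕ → ℕ} (hμ : Monotone μ) (s : ℕ) :
    ∀ a l : ℕ, l ≤ k → IsPositive (windowMinor (xSeq k m) (ySeq k m) μ s a l) := by
  induction s with
  | zero =>
    intro a l hl
    rw [windowMinor_zero_left _ _ _ (xSeq_injOn hl)]
    exact .prod _ fun j _ => .prod _ fun b _ => (isPositive_xSeq j).add (isPositive_ySeq b)
  | succ s ih =>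
    intro a l
    induction l generalizing a with
    | zero => exact fun _ => windowMinor_zero_right (xSeq k m) _ μ _ _ ▸ isPositive_one
    | succ l ihl =>
      intro hl
      by_cases h1 : s < μ a
      · rw [windowMinor_succ_of_lt _ _ hμ h1]
        exact ih _ _ hl
      by_cases h2 : μ (a + l) ≤ s
      · rw [windowMinor_succ_of_le _ _ hμ (by simpa using h2)]
        exact ih _ _ hl
      · have hne := ih (a + 1) l (by omega)
        rw [eq_div_of_mul_eq hne.ne_zero
          (windowMinor_exchange _ _ hμ (not_lt.mp h1) (not_le.mp h2))]
        exact (((ih _ _ hl).mul (ihl _ (by omega))).add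
          ((ih _ _ hl).mul (ihl _ (by omega)))).div hne

theorem zEntry_eq_zMatrix {i : ℕ} (hi : i ≤ m) (j : Fin k) :
    zEntry i j = zMatrix (xSeq k m) (ySeq k m) i j := by
  have hx : ∀ a : Fin k, xSeq k m a = xVar a := fun a => by simp [xSeq]
  have hy : ∀ b : Fin m, ySeq k m b = yVar b := fun b => by simp [ySeq]
  unfold zEntry zMatrix
  congr 1
  · refine Finset.prod_bij (fun b _ => b.val) (by simp) (fun _ _ _ _ => Fin.ext)
      (fun b hb => ⟨⟨b, by have := mem_range.mp hb; omega⟩, by simpa using hb, rfl⟩) ?_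
    intro b _
    rw [hx, hy]
  · refine Finset.prod_bij (fun b _ => b.val) (by simp) (fun _ _ _ _ => Fin.ext)
      (fun b hb => ⟨⟨b, by have := mem_range.mp hb; omega⟩,
        mem_filter.mpr ⟨mem_univ _, mem_range.mp hb⟩, rfl⟩) ?_
    intro b _
    rw [hx, hx]

/-- The parts of `λ` in increasing order, continued by `λ_1`. -/
def reversedPart (lam : Fin k → ℕ) (i : ℕ) : ℕ := (initState lam).mem (k - 1 - i)

theorem reversedPart_eq (hk : 0 < k) (lam : Fin k → ℕ) (i : ℕ) :
    reversedPart lam i = lam ⟨k - 1 - i, by omega⟩ :=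
  dif_pos (by omega)

theorem monotone_reversedPart {lam : Fin k → ℕ} (hk : 0 < k) (h : Antitone lam) :
    Monotone (reversedPart lam) := by
  intro i j hij
  rw [reversedPart_eq hk, reversedPart_eq hk]
  exact h (by simp only [Fin.mk_le_mk]; omega)

theorem doubleSchur_eq_windowMinor (hk : 0 < k) {lam : Fin k → ℕ} (h : Antitone lam) :
    doubleSchur (k + lam ⟨0, hk⟩ - 1) lam =
      windowMinor (xSeq k _) (ySeq k _) (reversedPart lam) (lam ⟨0, hk⟩) 0 k := by
  unfold doubleSchur windowMinor leadingMinor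
  congr 1
  ext r j
  have hr : reversedPart lam r = lam r.rev := by
    rw [reversedPart_eq hk]
    congr 1
    simp only [Fin.ext_iff, Fin.val_rev]
    omega
  have hle : lam r.rev ≤ lam ⟨0, hk⟩ := h (by simp [Fin.le_def])
  have hrow : rowSeq (reversedPart lam) (lam ⟨0, hk⟩) (0 + r) = schurRow lam r := by
    rw [rowSeq, zero_add, hr, min_eq_right hle, schurRow, add_comm]
  have := r.isLt
  change zEntry (schurRow lam r) j = zMatrix _ _ (rowSeq _ _ (0 + r)) j
  -- The remaining goal is that the row is at most `k + λ_1 - 1`, so that the continuation of `y` by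
  -- `1` is never met.
  rw [hrow, zEntry_eq_zMatrix]
  unfold schurRow
  omega

end Positive

/-! ## The circuit -/

section Circuits

variable {k m : ℕ}

/-- All nodes of `c` are legitimate and correctly evaluated by `v`. -/
def Circuit.Valid (c : Circuit) (v : ℕ → RatFun k m) : Prop :=
  ∀ (t : ℕ) (ht : t < c.length), (c.get ⟨t, ht⟩).Holds v t

/-- The gate may be used at position `t`, after nodes with values `v`. -/
def Gate.Legal (v : ℕ → RatFun k m) (t : ℕ) : Gate ℕ → Prop
  | x i => i < k
  | y i => i < m
  | scalar c => 0 < c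
  | add a b => a < t ∧ b < t
  | mul a b => a < t ∧ b < t
  | div a b => a < t ∧ b < t ∧ v b ≠ 0

/-- Total, with value `1` for variables out of range. Together with `Gate.Legal` it separates the
side conditions of `Gate.Holds` from its equation. -/
noncomputable def Gate.value (v : ℕ → RatFun k m) : Gate ℕ → RatFun k m
  | x i => xSeq k m i
  | y i => ySeq k m i
  | scalar c => c
  | add a b => v a + v b
  | mul a b => v a * v b
  | div a b => v a / v b

theorem Gate.holds_iff (v : ℕ → RatFun k m) (t : ℕ) (g : Gate ℕ) :
    g.Holds v t ↔ g.Legal v t ∧ v t = g.value v := by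
  cases g with
  | x i =>
    simp only [Holds, Legal, value, xSeq]
    exact ⟨fun ⟨h, e⟩ => ⟨h, by rw [e, dif_pos h]⟩, fun ⟨h, e⟩ => ⟨h, by rw [e, dif_pos h]⟩⟩
  | y i =>
    simp only [Holds, Legal, value, ySeq]
    exact ⟨fun ⟨h, e⟩ => ⟨h, by rw [e, dif_pos h]⟩, fun ⟨h, e⟩ => ⟨h, by rw [e, dif_pos h]⟩⟩
  | _ => simp [Holds, Legal, value, and_assoc]

theorem Gate.Legal.congr {v v' : ℕ → RatFun k m} {t : ℕ} {g : Gate ℕ}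
    (hv : ∀ i < t, v' i = v i) (h : g.Legal v t) : g.Legal v' t ∧ g.value v' = g.value v := by
  cases g with
  | add a b => exact ⟨h, by simp only [value, hv a h.1, hv b h.2]⟩
  | mul a b => exact ⟨h, by simp only [value, hv a h.1, hv b h.2]⟩
  | div a b =>
    have h' : a < t ∧ b < t ∧ v b ≠ 0 := h
    exact ⟨⟨h'.1, h'.2.1, by rw [hv b h'.2.1]; exact h'.2.2⟩,
      by simp only [value, hv a h'.1, hv b h'.2.1]⟩
  | _ => exact ⟨h, rfl⟩

/-- Gates refer to earlier positions only, so `v` may be redefined at the new one. -/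
theorem Circuit.Valid.push {c : Circuit} {v : ℕ → RatFun k m} (hc : c.Valid v) {g : Gate ℕ}
    (hg : g.Legal v c.length) :
    ∃ v' : ℕ → RatFun k m, Circuit.Valid (c ++ [g]) v' ∧ (∀ t < c.length, v' t = v t) ∧
      v' c.length = g.value v := by
  have hv : ∀ t < c.length, Function.update v c.length (g.value v) t = v t := fun t ht =>
    Function.update_of_ne ht.ne _ _
  refine ⟨Function.update v c.length (g.value v), ?_, hv, by simp⟩
  intro t ht
  rw [Gate.holds_iff]
  rcases Nat.lt_or_ge t c.length with h | h
  · have h1 := (Gate.holds_iff _ _ _).mp (hc t h)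
    have h2 := h1.1.congr fun i hi => hv i (hi.trans h)
    have h3 : (c ++ [g]).get ⟨t, ht⟩ = c.get ⟨t, h⟩ := by simp [List.getElem_append_left h]
    rw [h3, hv t h, h2.2]
    exact ⟨h2.1, h1.2⟩
  · obtain rfl : t = c.length := by simp at ht; omega
    have h2 := hg.congr hv
    have h3 : (c ++ [g]).get ⟨c.length, ht⟩ = g := by simp
    rw [h3, h2.2]
    exact ⟨h2.1, by simp⟩

theorem Circuit.Valid.push_replicate {c : Circuit} {v : ℕ → RatFun k m} (hc : c.Valid v)
    {g : Gate ℕ} (hg : g.Legal v c.length) (r : ℕ) :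
    ∃ v' : ℕ → RatFun k m, Circuit.Valid (c ++ List.replicate r g) v' ∧
      (∀ t < c.length, v' t = v t) ∧ ∀ j < r, v' (c.length + j) = g.value v := by
  induction r with
  | zero => exact ⟨v, by simpa using hc, fun _ _ => rfl, by simp⟩
  | succ r ih =>
    obtain ⟨v', h1, h2, h3⟩ := ih
    have h4 := hg.congr h2
    have hl : Gate.Legal v' (c ++ List.replicate r g).length g := by
      have := h4.1
      rw [List.length_append]
      cases g <;> simp only [Gate.Legal] at this ⊢ <;> first | exact this | skip
      · exact ⟨by omega, by omega⟩
      · exact ⟨by omega, by omega⟩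
      · exact ⟨by omega, by omega, this.2.2⟩
    obtain ⟨v'', h5, h6, h7⟩ := h1.push hl
    refine ⟨v'', ?_, fun t ht => ?_, fun j hj => ?_⟩
    · rw [List.replicate_succ', ← List.append_assoc]
      exact h5
    · rw [h6 t (by simp; omega), h2 t ht]
    · rcases Nat.lt_or_ge j r with h | h
      · rw [h6 _ (by simpa using h), h3 j h]
      · obtain rfl : j = r := by omega
        simpa [h4.2] using h7

/-! ### The layout of the circuit in cells of five nodes. -/

/-- The serial number of the cell `(s, l, a)`, where `l ≤ k` and `a ≤ n`. -/
def cellIndex (k n s l a : ℕ) : ℕ := (s * (k + 1) + l) * (n + 1) + a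

/-- The position of node `j` of the cell `(s, l, a)`; every cell consists of five nodes. -/
def node (k n s l a j : ℕ) : ℕ := 5 * cellIndex k n s l a + j

/-- The nodes of the cell `(s, l, a)`. If `s + a + l ≤ n` then the last one computes the minor
`windowMinor μ s a l`, and if moreover `s = 0 < l` then the last but one computes
`∏ b < a, (x (l - 1) + y b)`. -/
def cell (μ : ℕ → ℕ) (k n s l a : ℕ) : List (Gate ℕ) :=
  if s + a + l - n ≠ 0 then List.replicate 5 (.scalar 1)
  else if s ≠ 0 then
    if μ a + 1 - s ≠ 0 then List.replicate 5 (.mul (node k n (s - 1) l (a + 1) 4) 0)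
    else if s - μ (a + l - 1) ≠ 0 then List.replicate 5 (.mul (node k n (s - 1) l a 4) 0)
    else
      [.mul (node k n (s - 1) l a 4) (node k n s (l - 1) (a + 1) 4),
        .mul (node k n (s - 1) l (a + 1) 4) (node k n s (l - 1) a 4),
        .add (node k n s l a 0) (node k n s l a 1),
        .div (node k n s l a 2) (node k n (s - 1) (l - 1) (a + 1) 4),
        .mul (node k n s l a 3) 0]
  else if l * a ≠ 0 then
    [.x (l - 1), .y (a - 1), .add (node k n s l a 0) (node k n s l a 1),
      .mul (node k n s l (a - 1) 3) (node k n s l a 2),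
      .mul (node k n s (l - 1) a 4) (node k n s l a 3)]
  else List.replicate 5 (.scalar 1)

theorem length_cell (μ : ℕ → ℕ) (k n s l a : ℕ) : (cell μ k n s l a).length = 5 := by
  unfold cell
  split_ifs <;> rfl

def cellRow (μ : ℕ → ℕ) (k n s l r : ℕ) : List (Gate ℕ) :=
  (List.range r).flatMap (cell μ k n s l)

def cellLayer (μ : ℕ → ℕ) (k n s r : ℕ) : List (Gate ℕ) :=
  (List.range r).flatMap fun l => cellRow μ k n s l (n + 1)

def cellLayers (μ : ℕ → ℕ) (k n r : ℕ) : List (Gate ℕ) :=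
  (List.range r).flatMap fun s => cellLayer μ k n s (k + 1)

theorem length_cellRow (μ : ℕ → ℕ) (k n s l r : ℕ) : (cellRow μ k n s l r).length = 5 * r := by
  simp [cellRow, List.length_flatMap, length_cell, mul_comm]

theorem length_cellLayer (μ : ℕ → ℕ) (k n s r : ℕ) :
    (cellLayer μ k n s r).length = r * (5 * (n + 1)) := by
  simp [cellLayer, List.length_flatMap, length_cellRow]

theorem length_cellLayers (μ : ℕ → ℕ) (k n r : ℕ) :
    (cellLayers μ k n r).length = r * ((k + 1) * (5 * (n + 1))) := by
  simp [cellLayers, List.length_flatMap, length_cellLayer]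

theorem cellIndex_lt {k n s l a s' l' a' : ℕ} (h : s * (k + 1) + l < s' * (k + 1) + l')
    (ha : a ≤ n) : cellIndex k n s l a < cellIndex k n s' l' a' := by
  unfold cellIndex
  have : (s * (k + 1) + l + 1) * (n + 1) ≤ (s' * (k + 1) + l') * (n + 1) :=
    Nat.mul_le_mul_right _ h
  rw [Nat.add_mul _ 1] at this
  omega

theorem cellIndex_injective {k n s l a s' l' a' : ℕ} (hl : l ≤ k) (hl' : l' ≤ k) (ha : a ≤ n)
    (ha' : a' ≤ n) (h : cellIndex k n s l a = cellIndex k n s' l' a') :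
    s = s' ∧ l = l' ∧ a = a' := by
  have hq : s * (k + 1) + l = s' * (k + 1) + l' := by
    rcases lt_trichotomy (s * (k + 1) + l) (s' * (k + 1) + l') with h' | h' | h'
    · exact absurd h (cellIndex_lt h' ha).ne
    · exact h'
    · exact absurd h (cellIndex_lt h' ha').ne'
  have hs : s = s' := by
    have h1 : (s * (k + 1) + l) / (k + 1) = s := by
      rw [mul_comm, Nat.mul_add_div (by omega), Nat.div_eq_of_lt (by omega), add_zero]
    have h2 : (s' * (k + 1) + l') / (k + 1) = s' := by
      rw [mul_comm, Nat.mul_add_div (by omega), Nat.div_eq_of_lt (by omega), add_zero]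
    rw [← h1, hq, h2]
  subst hs
  unfold cellIndex at h
  rw [hq] at h
  omega

/-- What the cell `(s, l, a)` computes. -/
def CellSpec (μ : ℕ → ℕ) (n : ℕ) (v : ℕ → RatFun k m) (s l a : ℕ) : Prop :=
  s + a + l ≤ n → v (node k n s l a 4) = windowMinor (xSeq k m) (ySeq k m) μ s a l ∧
    (s = 0 → 0 < l →
      v (node k n s l a 3) = ∏ b ∈ range a, (xSeq k m (l - 1) + ySeq k m b))

/-- The circuit `c` consists of the cells with serial numbers less than `i`. -/
def CellsBelow (k m : ℕ) (μ : ℕ → ℕ) (n : ℕ) (c : Circuit) (i : ℕ) : Prop :=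
  c.length = 5 * i ∧ ∃ v : ℕ → RatFun k m, c.Valid v ∧ (0 < i → v 0 = 1) ∧
    ∀ s l a, l ≤ k → a ≤ n → cellIndex k n s l a < i → CellSpec μ n v s l a

/-- The invariant passes from cell to cell because the minors needed by `(s, l, a)` belong to cells
with smaller serial number, still within `s + a + l ≤ n`. -/
theorem CellsBelow.step {μ : ℕ → ℕ} (hμ : Monotone μ) {n s l a : ℕ} (hm : m = n - 1) {c : Circuit}
    (hl : l ≤ k) (ha : a ≤ n) (h : CellsBelow k m μ n c (cellIndex k n s l a)) :
    CellsBelow k m μ n (c ++ cell μ k n s l a) (cellIndex k n s l a + 1) := by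
  obtain ⟨hlen, v, hv, hv0, hspec⟩ := h
  suffices hnew : ∃ v' : ℕ → RatFun k m, Circuit.Valid (c ++ cell μ k n s l a) v' ∧
      (∀ t < c.length, v' t = v t) ∧ (cellIndex k n s l a = 0 → v' 0 = 1) ∧
      CellSpec μ n v' s l a by
    obtain ⟨v', h1, h2, h3, h4⟩ := hnew
    refine ⟨by rw [List.length_append, length_cell, hlen]; ring, v', h1, fun _ => ?_, ?_⟩
    · rcases Nat.eq_zero_or_pos (cellIndex k n s l a) with h0 | h0
      · exact h3 h0
      · rw [h2 0 (by omega), hv0 h0]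
    · intro s' l' a' hl' ha' hlt hle
      rcases Nat.lt_succ_iff_lt_or_eq.mp hlt with hlt | heq
      · rw [h2 _ (by unfold node; omega), h2 _ (by unfold node; omega)]
        exact hspec s' l' a' hl' ha' hlt hle
      · obtain ⟨rfl, rfl, rfl⟩ := cellIndex_injective hl' hl ha' ha heq
        exact h4 hle
  have ones : ∃ v' : ℕ → RatFun k m, Circuit.Valid (c ++ List.replicate 5 (Gate.scalar 1)) v' ∧
      (∀ t < c.length, v' t = v t) ∧ (cellIndex k n s l a = 0 → v' 0 = 1) ∧
      ∀ j < 5, v' (node k n s l a j) = 1 := by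
    obtain ⟨v', h1, h2, h3⟩ := hv.push_replicate (g := Gate.scalar 1)
      (show Gate.Legal v _ _ from Nat.one_pos) 5
    have h4 : ∀ j < 5, v' (node k n s l a j) = 1 := fun j hj => by
      rw [node, ← hlen, h3 j hj]
      simp [Gate.value]
    refine ⟨v', h1, h2, fun h0 => ?_, h4⟩
    have := h4 0 (by omega)
    rwa [node, h0] at this
  -- Node `0` has the value `1`, so multiplying by it copies a value; the fivefold repetition pads
  -- the cell.
  have copy : ∀ s' l' a', 0 < cellIndex k n s l a → s ≠ 0 → l' ≤ k → a' ≤ n →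
      cellIndex k n s' l' a' < cellIndex k n s l a → s' + a' + l' ≤ n →
      windowMinor (xSeq k m) (ySeq k m) μ s a l = windowMinor (xSeq k m) (ySeq k m) μ s' a' l' →
      ∃ v' : ℕ → RatFun k m,
        Circuit.Valid (c ++ List.replicate 5 (Gate.mul (node k n s' l' a' 4) 0)) v' ∧
        (∀ t < c.length, v' t = v t) ∧ (cellIndex k n s l a = 0 → v' 0 = 1) ∧
        CellSpec μ n v' s l a := by
    intro s' l' a' hpos hs hl' ha' hlt hle heq
    obtain ⟨v', h1, h2, h3⟩ := hv.push_replicate (g := Gate.mul (node k n s' l' a' 4) 0)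
      (show Gate.Legal v _ _ from ⟨by unfold node; omega, by omega⟩) 5
    refine ⟨v', h1, h2, by omega, fun _ => ⟨?_, by omega⟩⟩
    rw [node, ← hlen, h3 4 (by omega), Gate.value, hv0 hpos, mul_one,
      (hspec s' l' a' hl' ha' hlt hle).1, heq]
  unfold cell
  split_ifs with hbig hs h1 h2 hla
  · obtain ⟨v', h1, h2, h3, h4⟩ := ones
    exact ⟨v', h1, h2, h3, fun _ => by omega⟩
  · obtain ⟨s, rfl⟩ := Nat.exists_eq_succ_of_ne_zero hs
    have hlt : cellIndex k n s l (a + 1) < cellIndex k n (s + 1) l a :=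
      cellIndex_lt (by rw [Nat.add_mul]; omega) (by omega)
    exact copy s l (a + 1) (Nat.zero_lt_of_lt hlt) hs hl (by omega) hlt (by omega)
      (windowMinor_succ_of_lt _ _ hμ (by omega) _)
  · obtain ⟨s, rfl⟩ := Nat.exists_eq_succ_of_ne_zero hs
    have hlt : cellIndex k n s l a < cellIndex k n (s + 1) l a :=
      cellIndex_lt (by rw [Nat.add_mul]; omega) ha
    exact copy s l a (Nat.zero_lt_of_lt hlt) hs hl ha hlt (by omega)
      (windowMinor_succ_of_le _ _ hμ (by omega))
  · obtain ⟨s, rfl⟩ := Nat.exists_eq_succ_of_ne_zero hs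
    -- For `l = 0` the index is `a - 1`, truncated, and monotonicity contradicts the failure of both
    -- tests. So `l > 0` in the exchange case.
    have hmono : l = 0 → μ (a + l - 1) ≤ μ a := fun h => hμ (by omega)
    obtain ⟨l, rfl⟩ := Nat.exists_eq_succ_of_ne_zero (fun h : l = 0 => by have := hmono h; omega)
    simp only [Nat.succ_eq_add_one, Nat.add_sub_cancel, ← add_assoc] at *
    have i1 : cellIndex k n s (l + 1) a < cellIndex k n (s + 1) (l + 1) a :=
      cellIndex_lt (by rw [Nat.add_mul]; omega) ha
    have i2 : cellIndex k n (s + 1) l (a + 1) < cellIndex k n (s + 1) (l + 1) a :=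
      cellIndex_lt (by omega) (by omega)
    have i3 : cellIndex k n s (l + 1) (a + 1) < cellIndex k n (s + 1) (l + 1) a :=
      cellIndex_lt (by rw [Nat.add_mul]; omega) (by omega)
    have i4 : cellIndex k n (s + 1) l a < cellIndex k n (s + 1) (l + 1) a :=
      cellIndex_lt (by omega) ha
    have i5 : cellIndex k n s l (a + 1) < cellIndex k n (s + 1) (l + 1) a :=
      cellIndex_lt (by rw [Nat.add_mul]; omega) (by omega)
    have w1 := (hspec _ _ _ hl ha i1 (by omega)).1
    have w2 := (hspec _ _ _ (by omega) (by omega) i2 (by omega)).1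
    have w3 := (hspec _ _ _ hl (by omega) i3 (by omega)).1
    have w4 := (hspec _ _ _ (by omega) ha i4 (by omega)).1
    have w5 := (hspec _ _ _ (by omega) (by omega) i5 (by omega)).1
    have hne := (isPositive_windowMinor (k := k) (m := m) hμ s (a + 1) l (by omega)).ne_zero
    have hone := hv0 (by omega)
    clear ones copy hspec hv0
    unfold CellSpec node at *
    generalize cellIndex k n (s + 1) (l + 1) a = T at *
    obtain ⟨v1, c1, a1, e1⟩ := hv.push (g := .mul (5 * cellIndex k n s (l + 1) a + 4)
      (5 * cellIndex k n (s + 1) l (a + 1) + 4)) ⟨by omega, by omega⟩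
    obtain ⟨v2, c2, a2, e2⟩ := c1.push (g := .mul (5 * cellIndex k n s (l + 1) (a + 1) + 4)
      (5 * cellIndex k n (s + 1) l a + 4)) ⟨by simp; omega, by simp; omega⟩
    obtain ⟨v3, c3, a3, e3⟩ := c2.push (g := .add (5 * T + 0) (5 * T + 1))
      ⟨by simp; omega, by simp; omega⟩
    have hw5 : v3 (5 * cellIndex k n s l (a + 1) + 4) =
        windowMinor (xSeq k m) (ySeq k m) μ s (a + 1) l := by
      rw [a3 _ (by simp; omega), a2 _ (by simp; omega), a1 _ (by omega), w5]
    obtain ⟨v4, c4, a4, e4⟩ := c3.push (g := .div (5 * T + 2)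
      (5 * cellIndex k n s l (a + 1) + 4)) ⟨by simp; omega, by simp; omega, by rwa [hw5]⟩
    obtain ⟨v5, c5, a5, e5⟩ := c4.push (g := .mul (5 * T + 3) 0)
      ⟨by simp; omega, by simp⟩
    simp only [List.length_append, List.length_cons, List.length_nil, hlen, Gate.value, zero_add,
      Nat.reduceAdd, List.append_assoc, List.cons_append, List.nil_append, add_zero]
      at a1 e1 a2 e2 a3 e3 a4 e4 a5 e5 c5
    have f0 : v4 0 = 1 := by
      rw [a4 _ (by omega), a3 _ (by omega), a2 _ (by omega), a1 _ (by omega), hone]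
    refine ⟨v5, c5, fun t ht => ?_, by omega, fun _ => ⟨?_, by omega⟩⟩
    · rw [a5 _ (by omega), a4 _ (by omega), a3 _ (by omega), a2 _ (by omega), a1 _ (by omega)]
    · rw [e5, f0, mul_one, e4, hw5, e3, e2, a2 _ (by omega), e1, a1 _ (by omega),
        a1 _ (by omega), w1, w2, w3, w4]
      symm
      apply eq_div_of_mul_eq hne
      exact windowMinor_exchange _ _ hμ (by omega) (by omega)
  -- At `s = 0` the fourth node accumulates the product of one column over `b < a`, and the fifth
  -- multiplies it into the minor with one column fewer.
  · obtain ⟨hl0, ha0⟩ := mul_ne_zero_iff.mp hla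
    obtain rfl : s = 0 := by omega
    obtain ⟨l, rfl⟩ := Nat.exists_eq_succ_of_ne_zero hl0
    obtain ⟨a, rfl⟩ := Nat.exists_eq_succ_of_ne_zero ha0
    simp only [Nat.succ_eq_add_one, Nat.add_sub_cancel] at *
    have i1 : cellIndex k n 0 (l + 1) a < cellIndex k n 0 (l + 1) (a + 1) := by
      unfold cellIndex; omega
    have i2 : cellIndex k n 0 l (a + 1) < cellIndex k n 0 (l + 1) (a + 1) :=
      cellIndex_lt (by omega) ha
    have w1 := (hspec _ _ _ hl (by omega) i1 (by omega)).2 rfl (by omega)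
    have w2 := (hspec _ _ _ (by omega) ha i2 (by omega)).1
    have hone := hv0 (by omega)
    clear ones copy hspec hv0
    unfold CellSpec node at *
    generalize cellIndex k n 0 (l + 1) (a + 1) = T at *
    obtain ⟨v1, c1, a1, e1⟩ := hv.push (g := .x l) (show l < k by omega)
    obtain ⟨v2, c2, a2, e2⟩ := c1.push (g := .y a) (show a < m by omega)
    obtain ⟨v3, c3, a3, e3⟩ := c2.push (g := .add (5 * T + 0) (5 * T + 1))
      ⟨by simp; omega, by simp; omega⟩
    obtain ⟨v4, c4, a4, e4⟩ := c3.push (g := .mul (5 * cellIndex k n 0 (l + 1) a + 3) (5 * T + 2))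
      ⟨by simp; omega, by simp; omega⟩
    obtain ⟨v5, c5, a5, e5⟩ := c4.push (g := .mul (5 * cellIndex k n 0 l (a + 1) + 4) (5 * T + 3))
      ⟨by simp; omega, by simp; omega⟩
    simp only [List.length_append, List.length_cons, List.length_nil, hlen, Gate.value, zero_add,
      add_assoc, Nat.reduceAdd, List.append_assoc, List.cons_append, List.nil_append, add_zero,
      Nat.add_sub_cancel] at a1 e1 a2 e2 a3 e3 a4 e4 a5 e5 c5 ⊢
    have f4 : v4 (5 * T + 3) = ∏ b ∈ range (a + 1), (xSeq k m l + ySeq k m b) := by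
      rw [e4, e3, e2, a2 _ (by omega), e1, a3 _ (by omega), a2 _ (by omega), a1 _ (by omega), w1,
        prod_range_succ, Nat.add_sub_cancel]
    refine ⟨v5, c5, fun t ht => ?_, by omega, fun _ => ⟨?_, fun _ _ => ?_⟩⟩
    · rw [a5 _ (by omega), a4 _ (by omega), a3 _ (by omega), a2 _ (by omega), a1 _ (by omega)]
    · rw [e5, f4, a4 _ (by omega), a3 _ (by omega), a2 _ (by omega), a1 _ (by omega), w2,
        windowMinor_zero_left _ _ _ (xSeq_injOn (by omega)),
        windowMinor_zero_left _ _ _ (xSeq_injOn hl), prod_range_succ _ l]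
    · rw [a5 _ (by omega), f4]
  · obtain rfl : s = 0 := by omega
    obtain ⟨v', h1, h2, h3, h4⟩ := ones
    refine ⟨v', h1, h2, h3, fun _ => ⟨?_, fun _ hl0 => ?_⟩⟩
    · rw [h4 4 (by omega), windowMinor_zero_left _ _ _ (xSeq_injOn hl)]
      have hla' : l * a = 0 := by omega
      rcases mul_eq_zero.mp hla' with rfl | rfl <;> simp
    · have : l * a = 0 := by omega
      obtain rfl : a = 0 := (mul_eq_zero.mp this).resolve_left hl0.ne'
      rw [h4 3 (by omega)]
      simp

theorem CellsBelow.row {μ : ℕ → ℕ} (hμ : Monotone μ) {n s l : ℕ} (hm : m = n - 1) {c : Circuit}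
    (hl : l ≤ k) (h : CellsBelow k m μ n c (cellIndex k n s l 0)) :
    ∀ r ≤ n + 1, CellsBelow k m μ n (c ++ cellRow μ k n s l r) (cellIndex k n s l r) := by
  intro r
  induction r with
  | zero => simpa [cellRow] using h
  | succ r ih =>
    intro hr
    have := (ih (by omega)).step hμ hm hl (by omega)
    rw [cellRow, List.range_succ, List.flatMap_append, ← List.append_assoc]
    simpa [cellRow, cellIndex, add_assoc] using this

theorem CellsBelow.layer {μ : ℕ → ℕ} (hμ : Monotone μ) {n s : ℕ} (hm : m = n - 1) {c : Circuit}
    (h : CellsBelow k m μ n c (cellIndex k n s 0 0)) :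
    ∀ r ≤ k + 1, CellsBelow k m μ n (c ++ cellLayer μ k n s r) (cellIndex k n s r 0) := by
  intro r
  induction r with
  | zero => simpa [cellLayer] using h
  | succ r ih =>
    intro hr
    have := (ih (by omega)).row hμ hm (by omega) (n + 1) le_rfl
    rw [cellLayer, List.range_succ, List.flatMap_append, ← List.append_assoc]
    have e : cellIndex k n s (r + 1) 0 = cellIndex k n s r (n + 1) := by
      unfold cellIndex; ring
    rw [e]
    simpa [cellLayer] using this

theorem cellsBelow_cellLayers {μ : ℕ → ℕ} (hμ : Monotone μ) {n : ℕ} (hm : m = n - 1) (r : ℕ) :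
    CellsBelow k m μ n (cellLayers μ k n r) (cellIndex k n r 0 0) := by
  induction r with
  | zero =>
    refine ⟨by simp [cellLayers, cellIndex], fun _ => 0, ?_, ?_, ?_⟩
    · intro t ht
      simp [cellLayers] at ht
    · simp [cellIndex]
    · simp [cellIndex]
  | succ r ih =>
    have := ih.layer hμ hm (k + 1) le_rfl
    rw [cellLayers, List.range_succ, List.flatMap_append]
    have e : cellIndex k n (r + 1) 0 0 = cellIndex k n r (k + 1) 0 := by
      unfold cellIndex; ring
    rw [e]
    simpa [cellLayers] using this

/-- The circuit that computes `s_λ` when `n = k + λ_1`. -/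
def schurCircuit (lam : Fin k → ℕ) (n r : ℕ) : Circuit :=
  -- The cell `(r, k, 0)` is followed by the padding cells `(r, k, a)` with `a > 0`, so its value
  -- must be copied to the end.
  cellLayers (reversedPart lam) k n (r + 1) ++ [.mul (node k n r k 0 4) 0]

theorem schurCircuit_computes (hk : 0 < k) {lam : Fin k → ℕ} (h : Antitone lam) :
    (schurCircuit lam (k + lam ⟨0, hk⟩) (lam ⟨0, hk⟩)).Computes
      (doubleSchur (k + lam ⟨0, hk⟩ - 1) lam) := by
  have hμ := monotone_reversedPart hk h
  rw [doubleSchur_eq_windowMinor hk h]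
  generalize lam ⟨0, hk⟩ = r
  obtain ⟨hlen, v, hv, hv0, hspec⟩ :=
    cellsBelow_cellLayers (k := k) (m := k + r - 1) hμ (n := k + r) rfl (r + 1)
  have hlt : cellIndex k (k + r) r k 0 < cellIndex k (k + r) (r + 1) 0 0 :=
    cellIndex_lt (by rw [Nat.add_mul]; omega) (by omega)
  obtain ⟨v', h1, h2, h3⟩ := hv.push (g := .mul (node k (k + r) r k 0 4) 0)
    ⟨by unfold node; omega, by omega⟩
  refine ⟨v', h1, by simp [schurCircuit], ?_⟩
  rw [schurCircuit, List.length_append, List.length_singleton, Nat.add_sub_cancel, h3, Gate.value,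
    hv0 (by omega), mul_one, (hspec r k 0 le_rfl (by omega) hlt (by omega)).1]

end Circuits

end DoubleSchur

namespace DoubleSchur

/-! ## Costs of programs without loops -/

/-- All numbers stored in `s`, and the number of emitted nodes, have at most `L` bits. -/
structure State.BitBounded (s : State) (L : ℕ) : Prop where
  reg : ∀ r, (s.reg r).size ≤ L
  mem : ∀ a, (s.mem a).size ≤ L
  out : s.out.length.size ≤ L

theorem size_add_le (a b : ℕ) : (a + b).size ≤ a.size + b.size + 1 := by
  rw [Nat.size_le]
  have ha := Nat.lt_size_self a
  have hb := Nat.lt_size_self b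
  have h1 : 2 ^ a.size ≤ 2 ^ (a.size + b.size) := Nat.pow_le_pow_right (by omega) (by omega)
  have h2 : 2 ^ b.size ≤ 2 ^ (a.size + b.size) := Nat.pow_le_pow_right (by omega) (by omega)
  rw [pow_succ]
  omega

theorem size_mul_le (a b : ℕ) : (a * b).size ≤ a.size + b.size := by
  rw [Nat.size_le, pow_add]
  exact Nat.mul_lt_mul'' (Nat.lt_size_self a) (Nat.lt_size_self b)

/-- A fixed expression performs a fixed number of operations on numbers of `O(L)` bits; only
multiplication is charged quadratically. -/
theorem Expr.exists_bound (e : Expr) : ∃ d, ∀ (s : State) (L : ℕ), 1 ≤ L → s.BitBounded L →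
    (e.eval s).size ≤ d * L ∧ e.cost s ≤ d * L ^ 2 := by
  induction e with
  | lit c =>
    refine ⟨c.size + 1, fun s L hL _ => ⟨?_, ?_⟩⟩
    · simp only [eval]
      nlinarith
    · simp only [cost]
      nlinarith [Nat.one_le_pow 2 L hL]
  | reg r =>
    refine ⟨2, fun s L hL hs => ⟨?_, ?_⟩⟩
    · have := hs.reg r
      simp only [eval]
      omega
    · have := hs.reg r
      simp only [cost]
      nlinarith
  | mem e ih =>
    obtain ⟨d, hd⟩ := ih
    refine ⟨2 * d + 2, fun s L hL hs => ⟨?_, ?_⟩⟩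
    · have := hs.mem (e.eval s)
      simp only [eval]
      nlinarith
    · obtain ⟨h1, h2⟩ := hd s L hL hs
      have := hs.mem (e.eval s)
      have h3 : d * L ≤ d * L ^ 2 := Nat.mul_le_mul_left _ (Nat.le_self_pow two_ne_zero L)
      simp only [cost]
      nlinarith
  | add e f ihe ihf =>
    obtain ⟨d, hd⟩ := ihe
    obtain ⟨d', hd'⟩ := ihf
    refine ⟨2 * d + 2 * d' + 1, fun s L hL hs => ?_⟩
    obtain ⟨h1, h2⟩ := hd s L hL hs
    obtain ⟨h1', h2'⟩ := hd' s L hL hs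
    have h3 : d * L ≤ d * L ^ 2 := Nat.mul_le_mul_left _ (Nat.le_self_pow two_ne_zero L)
    have h3' : d' * L ≤ d' * L ^ 2 := Nat.mul_le_mul_left _ (Nat.le_self_pow two_ne_zero L)
    have h4 := size_add_le (e.eval s) (f.eval s)
    have h5 := Nat.one_le_pow 2 L hL
    simp only [eval, cost]
    constructor <;> linarith [Nat.zero_le (d * L), Nat.zero_le (d' * L)]
  | sub e f ihe ihf =>
    obtain ⟨d, hd⟩ := ihe
    obtain ⟨d', hd'⟩ := ihf
    refine ⟨2 * d + 2 * d' + 1, fun s L hL hs => ?_⟩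
    obtain ⟨h1, h2⟩ := hd s L hL hs
    obtain ⟨h1', h2'⟩ := hd' s L hL hs
    have h3 : d * L ≤ d * L ^ 2 := Nat.mul_le_mul_left _ (Nat.le_self_pow two_ne_zero L)
    have h3' : d' * L ≤ d' * L ^ 2 := Nat.mul_le_mul_left _ (Nat.le_self_pow two_ne_zero L)
    have h4 := Nat.size_le_size (Nat.sub_le (e.eval s) (f.eval s))
    have h5 := Nat.one_le_pow 2 L hL
    simp only [eval, cost]
    constructor <;> linarith [Nat.zero_le (d * L), Nat.zero_le (d' * L)]
  | mul e f ihe ihf =>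
    obtain ⟨d, hd⟩ := ihe
    obtain ⟨d', hd'⟩ := ihf
    refine ⟨d + d' + (d + 1) * (d' + 1), fun s L hL hs => ?_⟩
    obtain ⟨h1, h2⟩ := hd s L hL hs
    obtain ⟨h1', h2'⟩ := hd' s L hL hs
    have h4 := size_mul_le (e.eval s) (f.eval s)
    simp only [eval, cost]
    constructor
    · nlinarith [Nat.zero_le ((d + 1) * (d' + 1) * L)]
    · have h6 : ((e.eval s).size + 1) * ((f.eval s).size + 1) ≤
          ((d + 1) * L) * ((d' + 1) * L) := Nat.mul_le_mul (by linarith) (by linarith)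
      nlinarith

theorem exists_bound_sum_cost (es : List Expr) : ∃ d, ∀ (s : State) (L : ℕ), 1 ≤ L →
    s.BitBounded L → (es.map (Expr.cost s)).sum ≤ d * L ^ 2 := by
  induction es with
  | nil => exact ⟨0, fun s L _ _ => by simp⟩
  | cons e es ih =>
    obtain ⟨d, hd⟩ := ih
    obtain ⟨d', hd'⟩ := e.exists_bound
    refine ⟨d' + d, fun s L hL hs => ?_⟩
    rw [List.map_cons, List.sum_cons, Nat.add_mul]
    exact Nat.add_le_add (hd' s L hL hs).2 (hd s L hL hs)

/-! ### Bounding the cost of runs. -/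

/-- The program `p`, started in the state `s`, halts in the state `s'` at a cost of at most `T`. -/
def RunsWithin (w : ℕ) (p : Program) (s s' : State) (T : ℕ) : Prop :=
  ∃ t, Exec w p s s' t ∧ t ≤ T

theorem RunsWithin.seq {w : ℕ} {p q : Program} {s s' s'' : State} {T T' : ℕ}
    (h : RunsWithin w p s s' T) (h' : RunsWithin w q s' s'' T') :
    RunsWithin w (.seq p q) s s'' (T + T') := by
  obtain ⟨t, h1, h2⟩ := h
  obtain ⟨t', h1', h2'⟩ := h'
  exact ⟨_, h1.seq h1', Nat.add_le_add h2 h2'⟩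

/-- A loop whose test counts down from `N`. -/
theorem RunsWithin.loop {w : ℕ} {e : Expr} {p : Program} {σ : ℕ → State} {N T U : ℕ}
    (hbody : ∀ i < N, RunsWithin w p (σ i) (σ (i + 1)) T)
    (heval : ∀ i ≤ N, e.eval (σ i) = N - i) (hcost : ∀ i ≤ N, e.cost (σ i) ≤ U) :
    RunsWithin w (.loop e p) (σ 0) (σ N) (N * (T + U + 1) + U + 1) := by
  suffices H : ∀ j i, i + j = N →
      RunsWithin w (.loop e p) (σ i) (σ N) (j * (T + U + 1) + U + 1) from H N 0 (by omega)
  intro j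
  induction j with
  | zero =>
    intro i hi
    obtain rfl : i = N := hi
    exact ⟨_, .loop_false (by rw [heval _ le_rfl]; omega), by
      have := hcost i le_rfl
      omega⟩
  | succ j ih =>
    intro i hi
    obtain ⟨t, h1, h2⟩ := hbody i (by omega)
    obtain ⟨t', h1', h2'⟩ := ih (i + 1) (by omega)
    refine ⟨_, .loop_true (by rw [heval _ (by omega)]; omega) h1 h1', ?_⟩
    have := hcost i (by omega)
    rw [Nat.add_mul j 1]
    omega

namespace Program

def LoopFree : Program → Prop
  | seq p q => p.LoopFree ∧ q.LoopFree
  | ite _ p q => p.LoopFree ∧ q.LoopFree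
  | loop _ _ => False
  | _ => True

/-- The final state of a run of a program without loops. -/
def run : Program → State → State
  | skip, s => s
  | set r e, s => { s with reg := Function.update s.reg r (e.eval s) }
  | store addr e, s => { s with mem := Function.update s.mem (addr.eval s) (e.eval s) }
  | emit g, s => { s with out := s.out ++ [g.map (Expr.eval s)] }
  | seq p q, s => q.run (p.run s)
  | ite e p q, s => if e.eval s ≠ 0 then p.run s else q.run s
  | loop _ _, s => s

theorem LoopFree.exists_bound {p : Program} (hp : p.LoopFree) : ∃ d, 1 ≤ d ∧
    ∀ (w : ℕ) (s : State) (L : ℕ), 1 ≤ L → s.BitBounded L →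
      RunsWithin w p s (p.run s) (d * (L ^ 2 + w ^ 2)) ∧ (p.run s).BitBounded (d * L) := by
  induction p with
  | skip =>
    refine ⟨1, le_rfl, fun w s L hL hs => ⟨⟨1, .skip s, ?_⟩, by simpa [run] using hs⟩⟩
    nlinarith [Nat.one_le_pow 2 L hL]
  | set r e =>
    obtain ⟨d, hd⟩ := e.exists_bound
    refine ⟨2 * d + 1, by omega, fun w s L hL hs => ?_⟩
    obtain ⟨h1, h2⟩ := hd s L hL hs
    have h3 : d * L ≤ d * L ^ 2 := Nat.mul_le_mul_left _ (Nat.le_self_pow two_ne_zero L)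
    have hL' : L ≤ (2 * d + 1) * L := Nat.le_mul_of_pos_left _ (by omega)
    refine ⟨⟨_, .set s r e, ?_⟩, fun r' => ?_, fun a => (hs.mem a).trans hL',
      hs.out.trans hL'⟩
    · nlinarith [Nat.one_le_pow 2 L hL, Nat.zero_le ((2 * d + 1) * w ^ 2)]
    · simp only [run, Function.update_apply]
      split
      · linarith [Nat.zero_le (d * L)]
      · exact (hs.reg r').trans hL'
  | store a e =>
    obtain ⟨d, hd⟩ := e.exists_bound
    obtain ⟨d', hd'⟩ := a.exists_bound
    refine ⟨2 * d + 2 * d' + 1, by omega, fun w s L hL hs => ?_⟩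
    obtain ⟨h1, h2⟩ := hd s L hL hs
    obtain ⟨h1', h2'⟩ := hd' s L hL hs
    have h3 : d * L ≤ d * L ^ 2 := Nat.mul_le_mul_left _ (Nat.le_self_pow two_ne_zero L)
    have h3' : d' * L ≤ d' * L ^ 2 := Nat.mul_le_mul_left _ (Nat.le_self_pow two_ne_zero L)
    have hL' : L ≤ (2 * d + 2 * d' + 1) * L := Nat.le_mul_of_pos_left _ (by omega)
    refine ⟨⟨_, .store s a e, ?_⟩, fun r => (hs.reg r).trans hL', fun b => ?_,
      hs.out.trans hL'⟩
    · nlinarith [Nat.one_le_pow 2 L hL, Nat.zero_le ((2 * d + 2 * d' + 1) * w ^ 2)]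
    · simp only [run, Function.update_apply]
      split
      · linarith [Nat.zero_le (d * L), Nat.zero_le (d' * L)]
      · exact (hs.mem b).trans hL'
  | emit g =>
    obtain ⟨d, hd⟩ := exists_bound_sum_cost g.operands
    refine ⟨d + 3, by omega, fun w s L hL hs => ?_⟩
    have h1 := hd s L hL hs
    have h2 := hs.out
    have h3 : L ≤ L ^ 2 := Nat.le_self_pow two_ne_zero L
    have hL' : L ≤ (d + 3) * L := Nat.le_mul_of_pos_left _ (by omega)
    refine ⟨⟨_, .emit s g, ?_⟩, fun r => (hs.reg r).trans hL', fun a => (hs.mem a).trans hL', ?_⟩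
    · nlinarith [Nat.zero_le (d * w ^ 2)]
    · have h4 := size_add_le s.out.length 1
      rw [Nat.size_one] at h4
      simp only [run, List.length_append, List.length_singleton]
      nlinarith
  | seq p q ihp ihq =>
    obtain ⟨d, hd1, hd⟩ := ihp hp.1
    obtain ⟨d', hd1', hd'⟩ := ihq hp.2
    -- The second program starts with numbers of up to `d * L` bits and costs at most `d' * ((d * L)
    -- ^ 2 + w ^ 2)`. For this reason the growth of the numbers is bounded along with the cost.
    refine ⟨d + d' * d ^ 2 + d' * d, by omega, fun w s L hL hs => ?_⟩
    obtain ⟨h1, h2⟩ := hd w s L hL hs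
    obtain ⟨h1', h2'⟩ := hd' w (p.run s) (d * L) (Nat.mul_pos hd1 hL) h2
    have hmono : d' * (d * L) ≤ (d + d' * d ^ 2 + d' * d) * L := by
      nlinarith [Nat.zero_le (d * L), Nat.zero_le (d' * d ^ 2 * L)]
    obtain ⟨t, h3, h4⟩ := h1.seq h1'
    refine ⟨⟨t, h3, h4.trans ?_⟩, fun r => (h2'.reg r).trans hmono,
      fun a => (h2'.mem a).trans hmono, h2'.out.trans hmono⟩
    have h5 : d' * w ^ 2 ≤ d' * d ^ 2 * w ^ 2 :=
      Nat.mul_le_mul_right _ (Nat.le_mul_of_pos_right _ (Nat.pow_pos hd1))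
    nlinarith [Nat.zero_le (d' * d * (L ^ 2 + w ^ 2))]
  | ite e p q ihp ihq =>
    obtain ⟨c, hc⟩ := e.exists_bound
    obtain ⟨d, hd1, hd⟩ := ihp hp.1
    obtain ⟨d', hd1', hd'⟩ := ihq hp.2
    refine ⟨c + d + d' + 1, by omega, fun w s L hL hs => ?_⟩
    obtain ⟨⟨t, h1, h1t⟩, h2⟩ := hd w s L hL hs
    obtain ⟨⟨t', h1', h1t'⟩, h2'⟩ := hd' w s L hL hs
    have hcost := (hc s L hL hs).2
    have hone := Nat.one_le_pow 2 L hL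
    have hz : c * L ^ 2 ≤ c * (L ^ 2 + w ^ 2) := Nat.mul_le_mul_left _ (by omega)
    have e1 : (c + d + d' + 1) * (L ^ 2 + w ^ 2) = c * (L ^ 2 + w ^ 2) + d * (L ^ 2 + w ^ 2) +
      d' * (L ^ 2 + w ^ 2) + (L ^ 2 + w ^ 2) := by ring
    by_cases h : e.eval s = 0
    · have hr : (ite e p q).run s = q.run s := if_neg (not_not.mpr h)
      have hm : d' * L ≤ (c + d + d' + 1) * L := Nat.mul_le_mul_right _ (by omega)
      rw [hr]
      exact ⟨⟨_, .ite_false h h1', by omega⟩, fun r => (h2'.reg r).trans hm,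
        fun a => (h2'.mem a).trans hm, h2'.out.trans hm⟩
    · have hr : (ite e p q).run s = p.run s := if_pos h
      have hm : d * L ≤ (c + d + d' + 1) * L := Nat.mul_le_mul_right _ (by omega)
      rw [hr]
      exact ⟨⟨_, .ite_true h h1, by omega⟩, fun r => (h2.reg r).trans hm,
        fun a => (h2.mem a).trans hm, h2.out.trans hm⟩
  | loop e p => exact hp.elim

/-- Emit several gates. -/
def emits : List (Gate Expr) → Program
  | [] => skip
  | g :: gs => seq (emit g) (emits gs)

theorem loopFree_emits (gs : List (Gate Expr)) : (emits gs).LoopFree := by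
  induction gs with
  | nil => trivial
  | cons g gs ih => exact ⟨trivial, ih⟩

end Program

theorem Expr.eval_out (s : State) (c : Circuit) (e : Expr) :
    e.eval { s with out := c } = e.eval s := by
  induction e <;> simp_all [eval]

namespace Program

theorem run_emits (gs : List (Gate Expr)) (s : State) :
    (emits gs).run s = { s with out := s.out ++ gs.map (Gate.map (Expr.eval s)) } := by
  induction gs generalizing s with
  | nil => simp [emits, run]
  | cons g gs ih =>
    have : Expr.eval { s with out := s.out ++ [g.map (Expr.eval s)] } = Expr.eval s :=
      funext fun e => Expr.eval_out _ _ _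
    simp only [emits, run, ih, this]
    simp

/-- Moves the conditional from states to emitted gates, the form in which it occurs in `cell`. -/
theorem run_ite {α : Type*} {e : Expr} {p q : Program} {s : State} {c : ℕ} {a b : α} (f : α → State)
    (hc : e.eval s = c) (hp : p.run s = f a) (hq : q.run s = f b) :
    (ite e p q).run s = f (if c ≠ 0 then a else b) := by
  subst hc
  rw [run, apply_ite f, hp, hq]

end Program

/-! ## The program -/

/-- The registers hold `k` and the loop counters `s`, `l`, `a`. -/
def controlReg (k s l a : ℕ) : ℕ → ℕ
  | 0 => k
  | 1 => s
  | 2 => l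
  | 3 => a
  | _ => 0

/-- The states in a run of `schurProgram`; the memory is never changed. -/
def controlState {k : ℕ} (lam : Fin k → ℕ) (s l a : ℕ) (c : Circuit) : State where
  reg := controlReg k s l a
  mem := (initState lam).mem
  out := c

open Program

/-- `n = k + λ_1`. -/
def sizeExpr : Expr := .add (.reg 0) (.mem (.lit 0))

/-- The counterpart of `node`. -/
def nodeExpr (s l a : Expr) (j : ℕ) : Expr :=
  .add (.mul (.lit 5) (.add (.mul (.add (.mul s (.add (.reg 0) (.lit 1))) l)
    (.add sizeExpr (.lit 1))) a)) (.lit j)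

/-- The counterpart of `reversedPart`. -/
def partExpr (i : Expr) : Expr := .mem (.sub (.sub (.reg 0) (.lit 1)) i)

/-- The counterpart of `cell`. -/
def cellProgram : Program :=
  let s := Expr.reg 1
  let l := Expr.reg 2
  let a := Expr.reg 3
  let s' := Expr.sub s (.lit 1)
  let l' := Expr.sub l (.lit 1)
  let a' := Expr.add a (.lit 1)
  .ite (.sub (.add (.add s a) l) sizeExpr) (emits (List.replicate 5 (.scalar (.lit 1))))
    (.ite s
      (.ite (.sub (.add (partExpr a) (.lit 1)) s)
        (emits (List.replicate 5 (.mul (nodeExpr s' l a' 4) (.lit 0))))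
        (.ite (.sub s (partExpr (.sub (.add a l) (.lit 1))))
          (emits (List.replicate 5 (.mul (nodeExpr s' l a 4) (.lit 0))))
          (emits [.mul (nodeExpr s' l a 4) (nodeExpr s l' a' 4),
            .mul (nodeExpr s' l a' 4) (nodeExpr s l' a 4),
            .add (nodeExpr s l a 0) (nodeExpr s l a 1),
            .div (nodeExpr s l a 2) (nodeExpr s' l' a' 4),
            .mul (nodeExpr s l a 3) (.lit 0)])))
      (.ite (.mul l a)
        (emits [.x l', .y (.sub a (.lit 1)), .add (nodeExpr s l a 0) (nodeExpr s l a 1),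
          .mul (nodeExpr s l (.sub a (.lit 1)) 3) (nodeExpr s l a 2),
          .mul (nodeExpr s l' a 4) (nodeExpr s l a 3)])
        (emits (List.replicate 5 (.scalar (.lit 1))))))

def rowStep : Program := .seq cellProgram (.set 3 (.add (.reg 3) (.lit 1)))

def rowEnd : Program := .seq (.set 3 (.lit 0)) (.set 2 (.add (.reg 2) (.lit 1)))

def layerEnd : Program := .seq (.set 2 (.lit 0)) (.set 1 (.add (.reg 1) (.lit 1)))

def outputStep : Program := .emit (.mul (nodeExpr (.mem (.lit 0)) (.reg 0) (.lit 0) 4) (.lit 0))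

def rowTest : Expr := .sub (.add sizeExpr (.lit 1)) (.reg 3)

def layerTest : Expr := .sub (.add (.reg 0) (.lit 1)) (.reg 2)

def programTest : Expr := .sub (.add (.mem (.lit 0)) (.lit 1)) (.reg 1)

def rowProgram : Program := .loop rowTest rowStep

def layerProgram : Program := .loop layerTest (.seq rowProgram rowEnd)

/-- Run through all cells `(s, l, a)` with `s ≤ λ_1`, `l ≤ k`, `a ≤ n`, and repeat the value of the
cell `(λ_1, k, 0)`. -/
def schurProgram : Program := .seq (.loop programTest (.seq layerProgram layerEnd)) outputStep

/-! ### The effect of the loop-free parts of the program. -/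

section Run

variable {k : ℕ} (lam : Fin k → ℕ) (s l a : ℕ) (c : Circuit)

theorem initState_eq : initState lam = controlState lam 0 0 0 [] := by
  unfold initState controlState
  congr 1
  funext r
  rcases r with _ | _ | _ | _ | r <;> simp [controlReg]

theorem run_cellProgram : cellProgram.run (controlState lam s l a c) =
    controlState lam s l a
      (c ++ cell (reversedPart lam) k (k + (initState lam).mem 0) s l a) := by
  have he : ∀ gs, (emits gs).run (controlState lam s l a c) =
      controlState lam s l a (c ++ gs.map (Gate.map (Expr.eval (controlState lam s l a c)))) :=
    fun gs => run_emits gs _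
  -- The tests and operands of `cellProgram` evaluate by definition to those of `cell`.
  exact run_ite (fun b => controlState lam s l a (c ++ b)) rfl (he _)
    (run_ite (fun b => controlState lam s l a (c ++ b)) rfl
      (run_ite (fun b => controlState lam s l a (c ++ b)) rfl (he _)
        (run_ite (fun b => controlState lam s l a (c ++ b)) rfl (he _) (he _)))
      (run_ite (fun b => controlState lam s l a (c ++ b)) rfl (he _) (he _)))

theorem set_one (e : Expr) : (Program.set 1 e).run (controlState lam s l a c) =
    controlState lam (e.eval (controlState lam s l a c)) l a c := by
  unfold Program.run controlState
  congr 1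
  funext r
  rcases r with _ | _ | _ | _ | r <;> simp [controlReg]

theorem set_two (e : Expr) : (Program.set 2 e).run (controlState lam s l a c) =
    controlState lam s (e.eval (controlState lam s l a c)) a c := by
  unfold Program.run controlState
  congr 1
  funext r
  rcases r with _ | _ | _ | _ | r <;> simp [controlReg]

theorem set_three (e : Expr) : (Program.set 3 e).run (controlState lam s l a c) =
    controlState lam s l (e.eval (controlState lam s l a c)) c := by
  unfold Program.run controlState
  congr 1
  funext r
  rcases r with _ | _ | _ | _ | r <;> simp [controlReg]

theorem run_rowStep : rowStep.run (controlState lam s l a c) =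
    controlState lam s l (a + 1)
      (c ++ cell (reversedPart lam) k (k + (initState lam).mem 0) s l a) := by
  rw [rowStep, Program.run, run_cellProgram, set_three]
  rfl

theorem run_rowEnd : rowEnd.run (controlState lam s l a c) =
    controlState lam s (l + 1) 0 c := by
  rw [rowEnd, Program.run, set_three, set_two]
  rfl

theorem run_layerEnd : layerEnd.run (controlState lam s l a c) =
    controlState lam (s + 1) 0 a c := by
  rw [layerEnd, Program.run, set_two, set_one]
  rfl

end Run

theorem loopFree_rowStep : rowStep.LoopFree :=
  ⟨⟨loopFree_emits _, ⟨loopFree_emits _, loopFree_emits _, loopFree_emits _⟩,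
    loopFree_emits _, loopFree_emits _⟩, trivial⟩

/-- One constant bounds the costs of all parts of `schurProgram` that contain no loops. -/
theorem exists_bound_steps : ∃ d, 1 ≤ d ∧ ∀ (w : ℕ) (s : State) (L : ℕ), 1 ≤ L →
    s.BitBounded L →
      (∀ p ∈ [rowStep, rowEnd, layerEnd, outputStep],
        RunsWithin w p s (p.run s) (d * (L ^ 2 + w ^ 2))) ∧
      ∀ e ∈ [rowTest, layerTest, programTest], e.cost s ≤ d * (L ^ 2 + w ^ 2) := by
  obtain ⟨d₁, h₁, H₁⟩ := loopFree_rowStep.exists_bound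
  obtain ⟨d₂, -, H₂⟩ := Program.LoopFree.exists_bound (p := rowEnd) ⟨trivial, trivial⟩
  obtain ⟨d₃, -, H₃⟩ := Program.LoopFree.exists_bound (p := layerEnd) ⟨trivial, trivial⟩
  obtain ⟨d₄, -, H₄⟩ := Program.LoopFree.exists_bound (p := outputStep) trivial
  obtain ⟨d₅, H₅⟩ := rowTest.exists_bound
  obtain ⟨d₆, H₆⟩ := layerTest.exists_bound
  obtain ⟨d₇, H₇⟩ := programTest.exists_bound
  have mono : ∀ {w : ℕ} {p : Program} {s s' : State} {T T' : ℕ}, RunsWithin w p s s' T → T ≤ T' →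
      RunsWithin w p s s' T' := fun ⟨t, h, h'⟩ hT => ⟨t, h, h'.trans hT⟩
  refine ⟨d₁ + d₂ + d₃ + d₄ + d₅ + d₆ + d₇, by omega, fun w s L hL hs => ⟨?_, ?_⟩⟩
  · simp only [List.forall_mem_cons, List.not_mem_nil, false_imp_iff, implies_true, and_true]
    exact ⟨mono (H₁ w s L hL hs).1 (Nat.mul_le_mul_right _ (by omega)),
      mono (H₂ w s L hL hs).1 (Nat.mul_le_mul_right _ (by omega)),
      mono (H₃ w s L hL hs).1 (Nat.mul_le_mul_right _ (by omega)),
      mono (H₄ w s L hL hs).1 (Nat.mul_le_mul_right _ (by omega))⟩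
  · simp only [List.forall_mem_cons, List.not_mem_nil, false_imp_iff, implies_true, and_true]
    exact ⟨(H₅ s L hL hs).2.trans (Nat.mul_le_mul (by omega) (by omega)),
      (H₆ s L hL hs).2.trans (Nat.mul_le_mul (by omega) (by omega)),
      (H₇ s L hL hs).2.trans (Nat.mul_le_mul (by omega) (by omega))⟩

/-- The loop counters are in range, and no more nodes have been emitted than all the cells
contain. -/
structure InRange (k n r s l a : ℕ) (c : Circuit) : Prop where
  s_le : s ≤ r + 1
  l_le : l ≤ k + 1
  a_le : a ≤ n + 1
  length_le : c.length ≤ (r + 1) * ((k + 1) * (5 * (n + 1)))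

theorem InRange.bitBounded {k n r s l a : ℕ} {c : Circuit} (h : InRange k n r s l a c)
    {lam : Fin k → ℕ} (hk : 0 < k) (hn : n = k + r) (hlam : ∀ i, lam i ≤ r) :
    (controlState lam s l a c).BitBounded (8 * n.size) := by
  -- The node count dominates: `5 * (r + 1) * (k + 1) * (n + 1) ≤ 20 * n ^ 3`, by `r + 1 ≤ n` and `k
  -- + 1, n + 1 ≤ 2 * n`. Three times `n.size` bits suffice for `n ^ 3`, and five more bits for the
  -- factor `20 < 2 ^ 5`.
  have hbig : ∀ x, x ≤ 20 * n ^ 3 → x.size ≤ 8 * n.size := by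
    intro x hx
    have h1 : 1 ≤ n.size := Nat.size_pos.mpr (by omega)
    have h2 : n ^ 3 < (2 ^ n.size) ^ 3 := Nat.pow_lt_pow_left (Nat.lt_size_self n) (by omega)
    have h3 : 2 ^ 5 ≤ 2 ^ (5 * n.size) := Nat.pow_le_pow_right (by omega) (by omega)
    rw [Nat.size_le]
    calc x < 2 ^ 5 * (2 ^ n.size) ^ 3 := by omega
      _ ≤ 2 ^ (5 * n.size) * (2 ^ n.size) ^ 3 := Nat.mul_le_mul_right _ h3
      _ = 2 ^ (8 * n.size) := by rw [← pow_mul, ← pow_add]; congr 1; ring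
  have hn3 : n ≤ n ^ 3 := Nat.le_self_pow (by omega) n
  obtain ⟨h1, h2, h3, h4⟩ := h
  refine ⟨fun i => hbig _ ?_, fun i => hbig _ ?_, hbig _ ?_⟩
  · rcases i with _ | _ | _ | _ | i <;> simp only [controlState, controlReg] <;> omega
  · simp only [controlState, initState]
    split
    · have := hlam ⟨i, ‹_›⟩
      omega
    · omega
  · calc c.length ≤ (r + 1) * ((k + 1) * (5 * (n + 1))) := h4
      _ ≤ n * ((2 * n) * (5 * (2 * n))) := by gcongr <;> omega
      _ = 20 * n ^ 3 := by ring

/-! ### The three nested loops. -/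

section Loops

variable {k n r w U : ℕ} {lam : Fin k → ℕ}

/-- The parts of the program without loops run at a cost of at most `U` in all relevant states. -/
def StepsWithin (lam : Fin k → ℕ) (n r w U : ℕ) : Prop :=
  ∀ s l a c, InRange k n r s l a c →
    (∀ p ∈ [rowStep, rowEnd, layerEnd, outputStep],
      RunsWithin w p (controlState lam s l a c) (p.run (controlState lam s l a c)) U) ∧
    ∀ e ∈ [rowTest, layerTest, programTest], e.cost (controlState lam s l a c) ≤ U

theorem cells_le {s l : ℕ} (hs : s ≤ r) (hl : l ≤ k) {i : ℕ} (hi : i ≤ n + 1) :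
    s * ((k + 1) * (5 * (n + 1))) + (l * (5 * (n + 1)) + 5 * i) ≤
      (r + 1) * ((k + 1) * (5 * (n + 1))) := by
  calc s * ((k + 1) * (5 * (n + 1))) + (l * (5 * (n + 1)) + 5 * i)
      ≤ s * ((k + 1) * (5 * (n + 1))) + (k * (5 * (n + 1)) + 5 * (n + 1)) := by gcongr
    _ = (s + 1) * ((k + 1) * (5 * (n + 1))) := by ring
    _ ≤ _ := by gcongr

theorem runsWithin_rowProgram (h : StepsWithin lam n r w U) (hn : k + (initState lam).mem 0 = n)
    {s l : ℕ} {c : Circuit} (hs : s ≤ r) (hl : l ≤ k)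
    (hc : c.length = s * ((k + 1) * (5 * (n + 1))) + l * (5 * (n + 1))) :
    RunsWithin w rowProgram (controlState lam s l 0 c)
      (controlState lam s l (n + 1) (c ++ cellRow (reversedPart lam) k n s l (n + 1)))
      ((n + 1) * (U + U + 1) + U + 1) := by
  have hR : ∀ i ≤ n + 1, InRange k n r s l i (c ++ cellRow (reversedPart lam) k n s l i) :=
    fun i hi => ⟨by omega, by omega, hi, by
      have := cells_le hs hl hi
      rw [List.length_append, length_cellRow, hc]
      omega⟩
  -- After `i` rounds exactly the first `i` cells of the row have been appended; the two outer loops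
  -- have analogous invariants.
  have := RunsWithin.loop (w := w) (e := rowTest) (p := rowStep) (T := U) (U := U) (N := n + 1)
    (σ := fun i => controlState lam s l i (c ++ cellRow (reversedPart lam) k n s l i))
    (fun i hi => by
      have := (h _ _ _ _ (hR i hi.le)).1 rowStep (by simp)
      rw [run_rowStep, hn, List.append_assoc] at this
      simpa [cellRow, List.range_succ] using this)
    (fun i _ => by rw [← hn]; rfl)
    (fun i hi => (h _ _ _ _ (hR i hi)).2 rowTest (by simp))
  simpa [cellRow, rowProgram] using this

theorem runsWithin_layerProgram (h : StepsWithin lam n r w U)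
    (hn : k + (initState lam).mem 0 = n) {s : ℕ} {c : Circuit} (hs : s ≤ r)
    (hc : c.length = s * ((k + 1) * (5 * (n + 1)))) :
    RunsWithin w layerProgram (controlState lam s 0 0 c)
      (controlState lam s (k + 1) 0 (c ++ cellLayer (reversedPart lam) k n s (k + 1)))
      ((k + 1) * ((n + 1) * (U + U + 1) + U + 1 + U + U + 1) + U + 1) := by
  have hlen : ∀ l, (c ++ cellLayer (reversedPart lam) k n s l).length =
      s * ((k + 1) * (5 * (n + 1))) + l * (5 * (n + 1)) := fun l => by
    rw [List.length_append, length_cellLayer, hc]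
  have happ : ∀ l, c ++ cellLayer (reversedPart lam) k n s l ++
      cellRow (reversedPart lam) k n s l (n + 1) =
      c ++ cellLayer (reversedPart lam) k n s (l + 1) := fun l => by
    simp [cellLayer, List.range_succ]
  have hR : ∀ l ≤ k + 1, InRange k n r s l 0 (c ++ cellLayer (reversedPart lam) k n s l) :=
    fun l hl => ⟨by omega, hl, by omega, by
      rw [hlen]
      rcases Nat.lt_or_ge l (k + 1) with hl' | hl'
      · have := cells_le (n := n) hs (Nat.lt_succ_iff.mp hl') (Nat.zero_le _)
        omega
      · have := cells_le (n := n) hs (le_refl k) le_rfl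
        obtain rfl : l = k + 1 := by omega
        rw [Nat.add_mul k 1 (5 * (n + 1))] at *
        omega⟩
  have := RunsWithin.loop (w := w) (e := layerTest) (p := .seq rowProgram rowEnd)
    (T := (n + 1) * (U + U + 1) + U + 1 + U) (U := U) (N := k + 1)
    (σ := fun l => controlState lam s l 0 (c ++ cellLayer (reversedPart lam) k n s l))
    (fun l hl => by
      have h1 := runsWithin_rowProgram h hn hs (Nat.lt_succ_iff.mp hl) (hlen l)
      have h2 := (h s l (n + 1) (c ++ cellLayer (reversedPart lam) k n s (l + 1))
        ⟨by omega, by omega, le_rfl, (hR (l + 1) hl).length_le⟩).1 rowEnd (by simp)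
      rw [run_rowEnd] at h2
      rw [happ] at h1
      exact h1.seq h2)
    (fun l _ => rfl)
    (fun l hl => (h _ _ _ _ (hR l hl)).2 layerTest (by simp))
  simpa [cellLayer, layerProgram] using this

theorem runsWithin_schurProgram (h : StepsWithin lam n r w U)
    (hr : (initState lam).mem 0 = r) (hn : k + r = n) :
    ∃ s : State, s.out = schurCircuit lam n r ∧ RunsWithin w schurProgram (initState lam) s
      ((r + 1) * ((k + 1) * ((n + 1) * (U + U + 1) + U + 1 + U + U + 1) + U + 1 + U + U + 1) +
        U + 1 + U) := by
  have hlen : ∀ s, (cellLayers (reversedPart lam) k n s).length =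
      s * ((k + 1) * (5 * (n + 1))) := fun s => length_cellLayers _ _ _ _
  have happ : ∀ s, cellLayers (reversedPart lam) k n s ++
      cellLayer (reversedPart lam) k n s (k + 1) = cellLayers (reversedPart lam) k n (s + 1) :=
    fun s => by simp [cellLayers, List.range_succ]
  have hR : ∀ s ≤ r + 1, InRange k n r s 0 0 (cellLayers (reversedPart lam) k n s) :=
    fun s hs => ⟨hs, by omega, by omega, by rw [hlen]; gcongr⟩
  have := RunsWithin.loop (w := w) (e := programTest) (p := .seq layerProgram layerEnd)
    (T := (k + 1) * ((n + 1) * (U + U + 1) + U + 1 + U + U + 1) + U + 1 + U) (U := U) (N := r + 1)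
    (σ := fun s => controlState lam s 0 0 (cellLayers (reversedPart lam) k n s))
    (fun s hs => by
      have h1 := runsWithin_layerProgram h (by rw [hr, hn]) (Nat.lt_succ_iff.mp hs) (hlen s)
      have h2 := (h s (k + 1) 0 (cellLayers (reversedPart lam) k n (s + 1))
        ⟨by omega, le_rfl, by omega, (hR (s + 1) hs).length_le⟩).1 layerEnd (by simp)
      rw [run_layerEnd] at h2
      rw [happ] at h1
      exact h1.seq h2)
    (fun s _ => by rw [← hr]; rfl)
    (fun s hs => (h _ _ _ _ (hR s hs)).2 programTest (by simp))
  refine ⟨_, ?_, RunsWithin.seq (initState_eq lam ▸ by simpa [cellLayers] using this)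
    ((h _ _ _ _ (hR (r + 1) le_rfl)).1 outputStep (by simp))⟩
  subst hr hn
  rfl

end Loops

end DoubleSchur

/-- One program (the algorithm) handles all partitions `λ = (λ_1 ≥ … ≥ λ_k ≥ 0)`. With
`n = k + λ_1`, its run on `λ` executes a subtraction-free circuit of size `O(n ^ 3)` that computes
`s_λ(x_1, …, x_k | y)`, and costs `O(n ^ 3 log ^ 2 n)` bit operations when the arithmetic is done
on numbers of `A * log n = O(log n)` bits, for whatever constant `A`. -/
theorem theorem2p3 :
    ∃ P : DoubleSchur.Program, ∀ A : ℕ, ∃ C : ℕ,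
      ∀ (k n : ℕ) (hk : 0 < k) (lam : Fin k → ℕ), Antitone lam → n = k + lam ⟨0, hk⟩ →
        ∃ (s : DoubleSchur.State) (t : ℕ),
          DoubleSchur.Exec (A * n.size) P (DoubleSchur.initState lam) s t ∧
          s.out.Computes (DoubleSchur.doubleSchur (n - 1) lam) ∧
          s.out.length ≤ C * n ^ 3 ∧
          t ≤ C * n ^ 3 * n.size ^ 2 := by
  obtain ⟨d, hd1, hd⟩ := DoubleSchur.exists_bound_steps
  -- With `L = 8 * n.size` and `w = A * n.size` a step costs at most `U = d * (64 + A ^ 2) * n.size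
  -- ^ 2`. The loops cost at most `16 * (r + 1) * (k + 1) * (n + 1) * U ≤ 64 * n ^ 3 * U`. The `21`
  -- covers the size: `20 * n ^ 3` for the cells and one output node.
  refine ⟨DoubleSchur.schurProgram, fun A => ⟨64 * (d * (64 + A ^ 2)) + 21, ?_⟩⟩
  intro k n hk lam hlam hn
  have hmem : (DoubleSchur.initState lam).mem 0 = lam ⟨0, hk⟩ := dif_pos hk
  have hsize : 1 ≤ n.size := Nat.size_pos.mpr (by omega)
  have hcomp := DoubleSchur.schurCircuit_computes hk hlam
  rw [← hn] at hcomp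
  have hle : ∀ i, lam i ≤ lam ⟨0, hk⟩ := fun i => hlam (by simp [Fin.le_def])
  generalize lam ⟨0, hk⟩ = r at *
  generalize hU : d * ((8 * n.size) ^ 2 + (A * n.size) ^ 2) = U
  have hU' : U = d * (64 + A ^ 2) * n.size ^ 2 := by rw [← hU]; ring
  have hU1 : 1 ≤ U := by
    rw [hU']
    exact Nat.mul_pos (Nat.mul_pos hd1 (by omega)) (Nat.pow_pos hsize)
  have hsteps : DoubleSchur.StepsWithin lam n r (A * n.size) U := fun s l a c hR =>
    hU ▸ hd (A * n.size) _ _ (by omega) (hR.bitBounded hk hn hle)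
  obtain ⟨s, hs, t, ht, htle⟩ := DoubleSchur.runsWithin_schurProgram hsteps hmem hn.symm
  refine ⟨s, t, ht, hs ▸ hcomp, ?_, htle.trans ?_⟩
  · rw [hs, DoubleSchur.schurCircuit, List.length_append, DoubleSchur.length_cellLayers,
      List.length_singleton]
    have h1 : (r + 1) * ((k + 1) * (5 * (n + 1))) ≤ n * ((2 * n) * (5 * (2 * n))) := by
      gcongr <;> omega
    have h2 : 1 ≤ n ^ 3 := Nat.pow_pos (by omega)
    nlinarith [Nat.zero_le (64 * (d * (64 + A ^ 2)) * n ^ 3)]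
  -- Since `1 ≤ U`, all lower-order terms of each loop are absorbed in a multiple of its leading
  -- term.
  · have h1 : (n + 1) * (U + U + 1) + U + 1 ≤ 5 * ((n + 1) * U) := by nlinarith
    have h2 : (k + 1) * ((n + 1) * (U + U + 1) + U + 1 + U + U + 1) + U + 1 ≤
        10 * ((k + 1) * ((n + 1) * U)) := by
      calc _ ≤ (k + 1) * (8 * ((n + 1) * U)) + 2 * ((k + 1) * ((n + 1) * U)) := by
            have h3 : U ≤ (n + 1) * U := Nat.le_mul_of_pos_left _ (by omega)
            have h4 : (n + 1) * U ≤ (k + 1) * ((n + 1) * U) := Nat.le_mul_of_pos_left _ (by omega)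
            have h5 : (k + 1) * ((n + 1) * (U + U + 1) + U + 1 + U + U + 1) ≤
              (k + 1) * (8 * ((n + 1) * U)) := Nat.mul_le_mul_left _ (by omega)
            omega
        _ = _ := by ring
    have h3 : U ≤ (n + 1) * U := Nat.le_mul_of_pos_left _ (by omega)
    have h4 : (n + 1) * U ≤ (k + 1) * ((n + 1) * U) := Nat.le_mul_of_pos_left _ (by omega)
    have h5 : (k + 1) * ((n + 1) * U) ≤ (r + 1) * ((k + 1) * ((n + 1) * U)) :=
      Nat.le_mul_of_pos_left _ (by omega)
    have h6 : (r + 1) * ((k + 1) * ((n + 1) * (U + U + 1) + U + 1 + U + U + 1) +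
        U + 1 + U + U + 1) ≤ (r + 1) * (13 * ((k + 1) * ((n + 1) * U))) :=
      Nat.mul_le_mul_left _ (by omega)
    have h7 : (r + 1) * (13 * ((k + 1) * ((n + 1) * U))) =
      13 * ((r + 1) * ((k + 1) * ((n + 1) * U))) := by ring
    calc _ ≤ 16 * ((r + 1) * ((k + 1) * ((n + 1) * U))) := by omega
      _ ≤ 16 * (n * ((2 * n) * ((2 * n) * U))) := by gcongr <;> omega
      _ = 64 * (d * (64 + A ^ 2)) * n ^ 3 * n.size ^ 2 := by rw [hU']; ring
      _ ≤ _ := by gcongr; omega
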